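/- Let $p=2n+1$ be an odd prime, let $k$ be an algebraically closed field of characteristic $p$, and let $G=C_p$ be the cyclic group of order $p$. For $1\le i\le p$ let $V_i$ be the indecomposable $kG$-module of dimension $i$. For $1\le l\le p$ let $M_l$ be the action matrix of $V_l$, i.e. the $p\times p$ matrix whose $(i,j)$ entry is the multiplicity of $V_i$ as a direct summand of $V_l\otimes V_j$ ($1\le i,j\le p$). For $2\le l\le p-1$ let $|\lambda^{\mathrm{sec}}_l|$ be the second largest modulus of an eigenvalue of $M_l$, that is, the largest modulus among the eigenvalues of $M_l$ that are not of maximal modulus; for $l=1$, where $M_1$ is the identity matrix, set $|\lambda^{\mathrm{sec}}_1|=1$ by convention. Then: 1. For all $1\le l\le n$, $$|\lambda^{\mathrm{sec}}_l| = |\lambda^{\mathrm{sec}}_{p-l}| = \frac{\sin(l\pi/(2n+1))}{\sin(\pi/(2n+1))}.$$ 2. Let $\omega=\exp(2\pi i/p)$ and, for $1\le r,m\le n$, let $S_{r,m}=\sum_{j=1}^{2r}\bigl(\omega^{(p-2r+2j-1)/2}\bigr)^m$, the sum of the $m$-th powers of $2r$ consecutive $p$-th roots of unity. Then for every $1\le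 r\le n$ the eigenvalues of $M_{2r}$, counted with algebraic multiplicity, are $2r$ together with $S_{r,m}$ and $-S_{r,m}$ for $1\le m\le n$; and the eigenvalues of $M_{p-2r}$ are $p-2r$ together with $-S_{r,m}$ for $1\le m\le n$, each taken twice. -/

import Mathlib

/-- A representation is indecomposable if it is nonzero and is not the internal direct sum of two
nonzero subrepresentations. -/
def Representation.IsIndecomposable {k G V : Type*} [Field k] [Group G] [AddCommGroup V]
    [Module k V] (ρ : Representation k G V) : Prop :=
  Nontrivial V ∧ ∀ U W : Subrepresentation ρ, IsCompl U W → U = ⊥ ∨ W = ⊥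

/-- The multiplicity of `σ` as a direct summand of `ρ`: the largest `m` such that `ρ` has a direct
summand isomorphic to the direct sum of `m` copies of `σ`. For `σ` indecomposable and `ρ`
finite-dimensional this is, by Krull–Schmidt, the number of summands isomorphic to `σ` in any
decomposition of `ρ` into indecomposables. (The set contains `0` and is bounded by `dim ρ` as soon
as `σ ≠ 0` and `ρ` is finite-dimensional.) -/
noncomputable def Representation.summandMultiplicity {k G V W : Type*} [Field k] [Group G]
    [AddCommGroup V] [Module k V] [AddCommGroup W] [Module k W]
    (σ : Representation k G V) (ρ : Representation k G W) : ℕ :=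
  sSup {m : ℕ | ∃ U U' : Subrepresentation ρ, IsCompl U U' ∧
    Nonempty ((Representation.directSum fun _ : Fin m => σ).Equiv U.toRepresentation)}

/-- The action matrix of `σ` with respect to the family `V_1, …, V_p`: its `(i, j)` entry is the
multiplicity of `V_i` in `σ ⊗ V_j`. -/
noncomputable def actionMatrix {k G W : Type*} [Field k] [Group G] [AddCommGroup W] [Module k W]
    (σ : Representation k G W) (p : ℕ) {V : ℕ → Type*} [∀ i, AddCommGroup (V i)]
    [∀ i, Module k (V i)] (ρ : ∀ i, Representation k G (V i)) :
    Matrix (Finset.Icc 1 p) (Finset.Icc 1 p) ℂ :=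
  fun i j => ((ρ i).summandMultiplicity (σ.tprod (ρ j)) : ℂ)

/-- The second largest modulus of an eigenvalue of `M`: the largest modulus among the eigenvalues
which are not of maximal modulus. (The set is finite, so the supremum is a maximum unless all
eigenvalues have the same modulus; in that case the value is `0`.) -/
noncomputable def secondLargestModulus {ι : Type*} [Fintype ι] [DecidableEq ι]
    (M : Matrix ι ι ℂ) : ℝ :=
  sSup {r : ℝ | ∃ μ ∈ spectrum ℂ M, ‖μ‖ = r ∧ ∃ ν ∈ spectrum ℂ M, ‖μ‖ < ‖ν‖}

/-- The second largest eigenvalue modulus of the action matrix of `V_l`, where the value for `l = 1`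
(whose action matrix is the identity) is `1` by convention. -/
noncomputable def lambdaSec {k G : Type*} [Field k] [Group G] (p : ℕ) {V : ℕ → Type*}
    [∀ i, AddCommGroup (V i)] [∀ i, Module k (V i)] (ρ : ∀ i, Representation k G (V i))
    (l : ℕ) : ℝ :=
  if l = 1 then 1 else secondLargestModulus (actionMatrix (ρ l) p ρ)

/-- With `p = 2n + 1` and `ω = exp(2πi/p)`, the sum `∑_{j=1}^{2k} (ω^{(p-2k+2j-1)/2})^m` of the
`m`-th powers of `2k` consecutive `p`-th roots of unity; note `(p-2k+2j-1)/2 = n-k+j`. -/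
noncomputable def consecutiveRootSum (n k m : ℕ) : ℂ :=
  ∑ j ∈ Finset.Icc 1 (2 * k),
    (Complex.exp (2 * Real.pi * Complex.I / (2 * n + 1)) ^ (n - k + j)) ^ m

/-! Everything is read off from a generator `g`. Since `g ^ p = 1` in characteristic `p`, it acts
unipotently, and `V_i` is one Jordan block of size `i`. The multiplicity of `V_i` is then minus the
second difference at `i` of `j ↦ dim ker (g - 1) ^ j`; this is additive on direct sums, so
Krull–Schmidt is never invoked.

A Green ring character is a sequence with `a 0 = 0`, `a 1 = 1`, `a (i + 2) = t * a (i + 1) - a i`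
and `(2 - t) * a p = 0`. Kernel dimensions on `V_2 ⊗ W` are explicit in those of `W`
(`kerDim_twist`), and summation by parts shows that the character multiplies by `t` under `V_2 ⊗ -`.
The Clebsch–Gordan rule `V_2 ⊗ V_{l+1} = V_l ⊕ V_{l+2}` extends this to `a l` under `V_l ⊗ -`
(`greenChar_tensor`). Thus `(a i)` is a left eigenvector of every `M_l`, with eigenvalue `a l`.

The `p` distinct values `t = 2 cos (s π / p)`, `0 ≤ s < p`, give `p` characters, so all `M_l` are
diagonalised simultaneously. The eigenvalues of `M_l` are `l` (for `s = 0`) and `sin (l s π / p) /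
sin (s π / p)`. What remains is trigonometry: among `s ≥ 1` the modulus is largest at `s = 1`, and a
geometric series identifies these quotients with sums of roots of unity. -/

namespace UnipotentBlock

open Module TensorProduct

universe u v w

variable {k : Type w} [Field k]

/-- Two endomorphisms are similar if a linear equivalence intertwines them. -/
def Similar {V W : Type*} [AddCommGroup V] [Module k V] [AddCommGroup W] [Module k W]
    (f : End k V) (g : End k W) : Prop :=
  ∃ e : V ≃ₗ[k] W, ∀ x, e (f x) = g (e x)

/-! ### Similarity of endomorphisms, direct sums and tensor products -/

section Similar

variable {V W V' W' X : Type*} [AddCommGroup V] [Module k V] [AddCommGroup W] [Module k W]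
  [AddCommGroup V'] [Module k V'] [AddCommGroup W'] [Module k W'] [AddCommGroup X] [Module k X]

theorem Similar.refl (f : End k V) : Similar f f := ⟨LinearEquiv.refl k V, fun _ => rfl⟩

theorem Similar.symm {f : End k V} {g : End k W} : Similar f g → Similar g f := by
  rintro ⟨e, he⟩
  refine ⟨e.symm, fun x => ?_⟩
  rw [LinearEquiv.symm_apply_eq, he, LinearEquiv.apply_symm_apply]

theorem Similar.trans {f : End k V} {g : End k W} {h : End k X} :
    Similar f g → Similar g h → Similar f h := by
  rintro ⟨e, he⟩ ⟨e', he'⟩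
  exact ⟨e.trans e', fun x => by simp [he, he']⟩

theorem Similar.prodMap {f : End k V} {g : End k W} {f' : End k V'} {g' : End k W'}
    (h : Similar f g) (h' : Similar f' g') : Similar (f.prodMap f') (g.prodMap g') := by
  obtain ⟨e, he⟩ := h
  obtain ⟨e', he'⟩ := h'
  exact ⟨e.prodCongr e', fun x => by simp [he, he']⟩

theorem similar_prod_comm (f : End k V) (g : End k W) :
    Similar (f.prodMap g) (g.prodMap f) :=
  ⟨LinearEquiv.prodComm k V W, fun _ => rfl⟩

theorem similar_prod_assoc (f : End k V) (g : End k W) (h : End k X) :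
    Similar ((f.prodMap g).prodMap h) (f.prodMap (g.prodMap h)) :=
  ⟨LinearEquiv.prodAssoc k V W X, fun _ => rfl⟩

theorem Similar.tensorMap {f : End k V} {g : End k W} {f' : End k V'} {g' : End k W'}
    (h : Similar f g) (h' : Similar f' g') :
    Similar (TensorProduct.map f f') (TensorProduct.map g g') := by
  obtain ⟨e, he⟩ := h
  obtain ⟨e', he'⟩ := h'
  refine ⟨TensorProduct.congr e e', fun x => ?_⟩
  induction x with
  | zero => simp
  | add x y hx hy => simp [hx, hy]
  | tmul x y => simp [he, he']

theorem similar_tensor_assoc (f : End k V) (g : End k W) (h : End k X) :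
    Similar (TensorProduct.map (TensorProduct.map f g) h)
      (TensorProduct.map f (TensorProduct.map g h)) := by
  refine ⟨TensorProduct.assoc k V W X, fun x => ?_⟩
  exact LinearMap.congr_fun (TensorProduct.map_map_comp_assoc_eq f g h).symm x

theorem similar_prod_tensor (f : End k V) (g : End k W) (h : End k X) :
    Similar (TensorProduct.map (f.prodMap g) h)
      ((TensorProduct.map f h).prodMap (TensorProduct.map g h)) := by
  refine ⟨TensorProduct.prodLeft k k V W X, fun x => ?_⟩
  induction x with
  | zero => simp only [map_zero]
  | add x y hx hy => simp only [map_add, hx, hy]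
  | tmul x y =>
    obtain ⟨a, b⟩ := x
    simp

theorem similar_copies_zero (h : End k V) (f : End k W) :
    Similar f ((h.compLeft (Fin 0)).prodMap f) :=
  ⟨LinearEquiv.uniqueProd.symm, fun _ => Prod.ext (Subsingleton.elim _ _) rfl⟩

theorem similar_copies_succ (h : End k V) (m : ℕ) :
    Similar (h.prodMap (h.compLeft (Fin m))) (h.compLeft (Fin (m + 1))) := by
  refine ⟨Fin.consLinearEquiv k (fun _ : Fin (m + 1) => V), fun x => ?_⟩
  funext i
  exact Fin.cases rfl (fun j => rfl) i

theorem similar_prod_restrict {f : End k V} {U U' : Submodule k V} (hU : ∀ x ∈ U, f x ∈ U)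
    (hU' : ∀ x ∈ U', f x ∈ U') (hc : IsCompl U U') :
    Similar f ((f.restrict hU).prodMap (f.restrict hU')) := by
  apply Similar.symm
  refine ⟨Submodule.prodEquivOfIsCompl U U' hc, fun x => ?_⟩
  simp

theorem Similar.pow_sub_one {f : End k V} {g : End k W} (h : Similar f g) (i : ℕ) :
    Similar ((f - 1) ^ i) ((g - 1) ^ i) := by
  obtain ⟨e, he⟩ := h
  refine ⟨e, fun x => ?_⟩
  induction i generalizing x with
  | zero => simp
  | succ i ih => simp [pow_succ, ih, he]

theorem Similar.eq_zero {f : End k V} {g : End k W} (h : Similar f g) (hf : f = 0) : g = 0 := by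
  obtain ⟨e, he⟩ := h
  ext x
  obtain ⟨y, rfl⟩ := e.surjective x
  simp [← he, hf]

theorem Similar.pow_sub_one_eq_zero {f : End k V} {g : End k W} (h : Similar f g) {i : ℕ}
    (hf : (f - 1) ^ i = 0) : (g - 1) ^ i = 0 :=
  (h.pow_sub_one i).eq_zero hf

theorem prodMap_sub_one_pow (f : End k V) (g : End k W) (i : ℕ) :
    (f.prodMap g - 1 : End k (V × W)) ^ i = LinearMap.prodMap ((f - 1) ^ i) ((g - 1) ^ i) := by
  induction i with
  | zero => rfl
  | succ i ih =>
    rw [pow_succ, ih]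
    refine LinearMap.ext fun x => ?_
    simp [pow_succ]

theorem pow_sub_one_eq_zero_of_prodMap {f : End k V} {g : End k W} {i : ℕ}
    (h : (f.prodMap g - 1 : End k (V × W)) ^ i = 0) : (f - 1) ^ i = 0 ∧ (g - 1) ^ i = 0 := by
  rw [prodMap_sub_one_pow] at h
  constructor
  · ext x
    simpa using congrArg Prod.fst (LinearMap.congr_fun h (x, 0))
  · ext x
    simpa using congrArg Prod.snd (LinearMap.congr_fun h (0, x))

end Similar

/-! ### Kernel dimensions and block multiplicities -/

section KerDim

variable {V W : Type*} [AddCommGroup V] [Module k V] [AddCommGroup W] [Module k W]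

/-- The dimension of the kernel of `(f - 1) ^ i`. -/
noncomputable def kerDim (i : ℕ) (f : End k V) : ℕ :=
  finrank k (LinearMap.ker ((f - 1) ^ i))

/-- The number of unipotent Jordan blocks of size `i` of `f`. -/
noncomputable def blockMult (i : ℕ) (f : End k V) : ℤ :=
  2 * kerDim i f - kerDim (i - 1) f - kerDim (i + 1) f

theorem kerDim_zero (f : End k V) : kerDim 0 f = 0 := by
  rw [kerDim, pow_zero, LinearMap.ker_eq_bot.2 (fun _ _ h => h)]
  simp

theorem kerDim_of_pow_eq_zero {f : End k V} {i : ℕ} (h : (f - 1) ^ i = 0) :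
    kerDim i f = finrank k V := by
  rw [kerDim, h, LinearMap.ker_zero, finrank_top]

theorem Similar.kerDim_eq {f : End k V} {g : End k W} (h : Similar f g) (i : ℕ) :
    kerDim i f = kerDim i g := by
  obtain ⟨e, he⟩ := h.pow_sub_one i
  refine (e.ofSubmodules _ _ ?_).finrank_eq
  ext x
  simp only [Submodule.mem_map, LinearMap.mem_ker]
  constructor
  · rintro ⟨y, hy, rfl⟩
    have := he y
    simp_all
  · intro hx
    refine ⟨e.symm x, e.injective ?_, by simp⟩
    rw [he]
    simp [hx]

theorem Similar.blockMult_eq {f : End k V} {g : End k W} (h : Similar f g) (i : ℕ) :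
    blockMult i f = blockMult i g := by
  simp [blockMult, h.kerDim_eq]

theorem finrank_submodule_prod [FiniteDimensional k V] [FiniteDimensional k W]
    (p : Submodule k V) (q : Submodule k W) :
    finrank k (p.prod q) = finrank k p + finrank k q := by
  rw [← finrank_prod]
  exact LinearEquiv.finrank_eq
    { toFun := fun x => (⟨x.1.1, x.2.1⟩, ⟨x.1.2, x.2.2⟩)
      invFun := fun x => ⟨(x.1.1, x.2.1), x.1.2, x.2.2⟩
      map_add' := fun _ _ => rfl
      map_smul' := fun _ _ => rfl }

theorem kerDim_prodMap [FiniteDimensional k V] [FiniteDimensional k W] (f : End k V)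
    (g : End k W) (i : ℕ) : kerDim i (f.prodMap g) = kerDim i f + kerDim i g := by
  rw [kerDim, prodMap_sub_one_pow, LinearMap.ker_prodMap, kerDim, kerDim, finrank_submodule_prod]

theorem blockMult_prodMap [FiniteDimensional k V] [FiniteDimensional k W] (f : End k V)
    (g : End k W) (i : ℕ) : blockMult i (f.prodMap g) = blockMult i f + blockMult i g := by
  simp only [blockMult, kerDim_prodMap]
  push_cast
  ring

theorem blockMult_of_subsingleton [Subsingleton V] (f : End k V) (i : ℕ) : blockMult i f = 0 := by
  have (j : ℕ) : kerDim j f = 0 := finrank_zero_of_subsingleton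
  simp [blockMult, this]

theorem blockMult_copies [FiniteDimensional k V] (h : End k V) (i m : ℕ) :
    blockMult i (h.compLeft (Fin m)) = m * blockMult i h := by
  induction m with
  | zero => simp [blockMult_of_subsingleton]
  | succ m ih =>
    rw [← (similar_copies_succ h m).blockMult_eq, blockMult_prodMap, ih]
    push_cast
    ring

end KerDim

/-! ### Jordan blocks and how they split off -/

section Block

variable {V W : Type*} [AddCommGroup V] [Module k V] [AddCommGroup W] [Module k W]

/-- `f` is a single unipotent Jordan block of size `d`. -/
def IsBlock (d : ℕ) (f : End k V) : Prop :=
  ∃ b : Basis (Fin d) k V, ∀ a : Fin d,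
    (f - 1) (b a) = if h : (a : ℕ) + 1 < d then b ⟨a + 1, h⟩ else 0

theorem IsBlock.similar {d : ℕ} {f : End k V} {g : End k W} (hf : IsBlock d f)
    (hg : IsBlock d g) : Similar f g := by
  obtain ⟨b, hb⟩ := hf
  obtain ⟨c, hc⟩ := hg
  refine ⟨b.equiv c (Equiv.refl _), fun x => ?_⟩
  have key : (b.equiv c (Equiv.refl _)).toLinearMap ∘ₗ (f - 1) =
      (g - 1) ∘ₗ (b.equiv c (Equiv.refl _)).toLinearMap := by
    refine b.ext fun a => ?_
    simp only [LinearMap.comp_apply, hb, LinearEquiv.coe_coe, Basis.equiv_apply,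
      Equiv.refl_apply, hc]
    split_ifs <;> simp
  have := LinearMap.congr_fun key x
  simpa using this

theorem IsBlock.finrank_eq {d : ℕ} {f : End k V} (hf : IsBlock d f) : finrank k V = d := by
  obtain ⟨b, -⟩ := hf
  simpa using finrank_eq_card_basis b

theorem IsBlock.finiteDimensional {d : ℕ} {f : End k V} (hf : IsBlock d f) :
    FiniteDimensional k V := by
  obtain ⟨b, -⟩ := hf
  exact b.finiteDimensional_of_finite

/-- The power `(f - 1) ^ i` shifts the basis by `i`, so its range is spanned by the last `d - i`
basis vectors (truncated subtraction); rank-nullity does the rest. -/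
theorem IsBlock.kerDim_eq {d : ℕ} {f : End k V} (hf : IsBlock d f) (i : ℕ) :
    kerDim i f = min i d := by
  have := hf.finiteDimensional
  have hd := hf.finrank_eq
  obtain ⟨b, hb⟩ := hf
  have hpow (i : ℕ) (a : Fin d) :
      ((f - 1) ^ i) (b a) = if h : (a : ℕ) + i < d then b ⟨a + i, h⟩ else 0 := by
    induction i with
    | zero => simp
    | succ i ih =>
      rw [pow_succ', Module.End.mul_apply, ih]
      by_cases h : (a : ℕ) + i < d
      · rw [dif_pos h, hb]
        rfl
      · rw [dif_neg h, dif_neg (by omega), map_zero]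
  have hrange : LinearMap.range ((f - 1) ^ i) =
      Submodule.span k (Set.range fun a : Fin (d - i) => b ⟨a + i, by omega⟩) := by
    rw [LinearMap.range_eq_map, ← b.span_eq, Submodule.map_span]
    apply le_antisymm
    · rw [Submodule.span_le]
      rintro _ ⟨_, ⟨a, rfl⟩, rfl⟩
      rw [hpow]
      split_ifs with h
      · exact Submodule.subset_span ⟨⟨a, by omega⟩, rfl⟩
      · exact Submodule.zero_mem _
    · rw [Submodule.span_le]
      rintro _ ⟨a, rfl⟩
      refine Submodule.subset_span ⟨b ⟨a, by omega⟩, ⟨_, rfl⟩, ?_⟩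
      rw [hpow, dif_pos (by dsimp; omega)]
  have hli : LinearIndependent k (fun a : Fin (d - i) => b ⟨a + i, by omega⟩) :=
    b.linearIndependent.comp (fun a : Fin (d - i) => (⟨a + i, by omega⟩ : Fin d))
      (fun x y h => by
        simp only [Fin.mk.injEq] at h
        ext
        omega)
  have hr := LinearMap.finrank_range_add_finrank_ker ((f - 1) ^ i)
  rw [hrange, finrank_span_eq_card hli, Fintype.card_fin, hd] at hr
  rw [kerDim]
  omega

/-- The function `i ↦ min i d` bends only at `d`, so its negated second difference there is `1` and
vanishes elsewhere. This justifies the formula defining `blockMult`; `i ≥ 1` keeps `i - 1` from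
truncating. -/
theorem IsBlock.blockMult_eq {d : ℕ} {f : End k V} (hf : IsBlock d f) (hd : 1 ≤ d) {i : ℕ}
    (hi : 1 ≤ i) : blockMult i f = if d = i then 1 else 0 := by
  simp only [blockMult, hf.kerDim_eq]
  split_ifs <;> omega

/-- A nonzero unipotent endomorphism has an invariant complemented subspace on which it is a single
Jordan block. -/
theorem exists_isCompl_isBlock [FiniteDimensional k V] [Nontrivial V] {f : End k V}
    (hf : IsNilpotent (f - 1)) :
    ∃ U U' : Submodule k V, ∃ hU : ∀ x ∈ U, f x ∈ U, (∀ x ∈ U', f x ∈ U') ∧ IsCompl U U' ∧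
      ∃ d, 1 ≤ d ∧ IsBlock d (f.restrict hU) := by
  set N : End k V := f - 1 with hN
  have hfN (x : V) : f x = N x + x := by simp [hN]
  obtain ⟨e, he⟩ : ∃ e, nilpotencyClass N = e + 1 :=
    Nat.exists_eq_succ_of_ne_zero (pos_nilpotencyClass_iff.2 hf).ne'
  have hz : N ^ (e + 1) = 0 := he ▸ pow_nilpotencyClass hf
  have hz' {j : ℕ} (hj : e < j) (x : V) : (N ^ j) x = 0 := by
    rw [pow_eq_zero_of_le hj hz, LinearMap.zero_apply]
  have hnz : N ^ e ≠ 0 := by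
    have := pow_pred_nilpotencyClass hf
    rwa [he] at this
  obtain ⟨v, hv⟩ : ∃ v, (N ^ e) v ≠ 0 := by
    by_contra! h
    exact hnz (LinearMap.ext h)
  obtain ⟨φ, hφ⟩ : ∃ φ : Dual k V, φ ((N ^ e) v) ≠ 0 := by
    by_contra! h
    exact hv ((forall_dual_apply_eq_zero_iff k _).1 h)
  -- The block is the cyclic space of `v`, parametrised by `L`; its complement is the kernel of `Φ`.
  -- The matrix of `Φ ∘ L` is `φ (N ^ (a + b) v)`: zero when `a + b > e` and equal to the nonzero `φ
  -- (N ^ e v)` when `a + b = e`. It is therefore invertible, which makes `range L` and `ker Φ`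
  -- complementary.
  let L : (Fin (e + 1) → k) →ₗ[k] V := Fintype.linearCombination k fun a => (N ^ (a : ℕ)) v
  let Φ : V →ₗ[k] (Fin (e + 1) → k) := LinearMap.pi fun a => φ ∘ₗ (N ^ (a : ℕ))
  have hL (c : Fin (e + 1) → k) : L c = ∑ a, c a • (N ^ (a : ℕ)) v :=
    Fintype.linearCombination_apply k _ c
  have hΦ (x : V) (a : Fin (e + 1)) : Φ x a = φ ((N ^ (a : ℕ)) x) := rfl
  have hinj : Function.Injective (Φ ∘ₗ L) := by
    rw [injective_iff_map_eq_zero]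
    intro c hc
    by_contra hne
    have hex : ∃ a, c a ≠ 0 := by
      by_contra! h
      exact hne (funext h)
    obtain ⟨a₀, ha₀, hmin⟩ := WellFounded.has_min (wellFounded_lt (α := Fin (e + 1)))
      {a | c a ≠ 0} hex
    -- In coordinate `e - a₀` the terms beyond `a₀` die because `N ^ (e + 1) = 0`, and those before
    -- it have zero coefficient by minimality of `a₀`.
    have h1 := congrFun hc ⟨e - a₀, by omega⟩
    rw [LinearMap.comp_apply, hΦ, hL, map_sum, map_sum, Finset.sum_eq_single a₀] at h1
    · rw [map_smul, map_smul, ← Module.End.mul_apply, ← pow_add] at h1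
      have : e - (a₀ : ℕ) + a₀ = e := by omega
      simp only [this, smul_eq_mul, Pi.zero_apply, mul_eq_zero] at h1
      exact h1.elim ha₀ hφ
    · intro b _ hb
      rw [map_smul, map_smul, ← Module.End.mul_apply, ← pow_add]
      rcases lt_or_gt_of_ne hb with h | h
      · have : c b = 0 := by
          by_contra h'
          exact hmin b h' h
        simp [this]
      · have h2 : (a₀ : ℕ) < b := h
        rw [hz' (by dsimp only; omega)]
        simp
    · simp
  have hLinj : Function.Injective L :=
    Function.Injective.of_comp (f := Φ) (by rwa [LinearMap.coe_comp] at hinj)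
  have hsurj : Function.Surjective (Φ ∘ₗ L) := LinearMap.injective_iff_surjective.1 hinj
  have hNL (a : Fin (e + 1)) : N (L (Pi.single a 1)) =
      if h : (a : ℕ) + 1 < e + 1 then L (Pi.single ⟨a + 1, h⟩ 1) else 0 := by
    simp only [L, Fintype.linearCombination_apply_single, one_smul]
    rw [← Module.End.mul_apply, ← pow_succ']
    split_ifs with h
    · rfl
    · exact hz' (by omega) v
  have hU : ∀ x ∈ LinearMap.range L, f x ∈ LinearMap.range L := by
    rintro _ ⟨c, rfl⟩
    rw [hfN]
    refine Submodule.add_mem _ ?_ ⟨c, rfl⟩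
    rw [← Finset.univ_sum_single c, map_sum, map_sum]
    refine Submodule.sum_mem _ fun a _ => ?_
    have : Pi.single a (c a) = c a • (Pi.single a 1 : Fin (e + 1) → k) := by
      rw [← Pi.single_smul, smul_eq_mul, mul_one]
    rw [this, map_smul, map_smul, hNL]
    refine Submodule.smul_mem _ _ ?_
    split_ifs
    · exact ⟨_, rfl⟩
    · exact Submodule.zero_mem _
  have hU' : ∀ x ∈ LinearMap.ker Φ, f x ∈ LinearMap.ker Φ := by
    intro x hx
    rw [hfN]
    refine Submodule.add_mem _ ?_ hx
    rw [LinearMap.mem_ker] at hx ⊢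
    funext a
    rw [hΦ, ← Module.End.mul_apply, ← pow_succ]
    by_cases h : (a : ℕ) + 1 < e + 1
    · exact congrFun hx ⟨a + 1, h⟩
    · rw [hz' (by omega), map_zero, Pi.zero_apply]
  refine ⟨LinearMap.range L, LinearMap.ker Φ, hU, hU', ⟨?_, ?_⟩, e + 1, by omega, ?_⟩
  · rw [Submodule.disjoint_def]
    rintro _ ⟨c, rfl⟩ hc
    have : c = 0 := hinj (by rw [LinearMap.comp_apply, LinearMap.mem_ker.1 hc, map_zero])
    rw [this, map_zero]
  · rw [codisjoint_iff, Submodule.eq_top_iff']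
    intro x
    obtain ⟨c, hc⟩ := hsurj (Φ x)
    refine Submodule.mem_sup.2 ⟨L c, ⟨c, rfl⟩, x - L c, ?_, by simp⟩
    rw [LinearMap.mem_ker, map_sub, ← hc, LinearMap.comp_apply, sub_self]
  · have hb (a : Fin (e + 1)) :
        ((Basis.ofEquivFun (LinearEquiv.ofInjective L hLinj).symm a : LinearMap.range L) : V) =
          L (Pi.single a 1) := by
      simp [Basis.coe_ofEquivFun]
    refine ⟨Basis.ofEquivFun (LinearEquiv.ofInjective L hLinj).symm, fun a => ?_⟩
    apply Subtype.ext
    have h1 : (((f.restrict hU - 1 : End k (LinearMap.range L))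
        (Basis.ofEquivFun (LinearEquiv.ofInjective L hLinj).symm a) : LinearMap.range L) : V) =
        N (L (Pi.single a 1)) := by
      rw [← hb a]
      simp only [hN, LinearMap.sub_apply, Module.End.one_apply, Submodule.coe_sub,
        LinearMap.coe_restrict_apply]
    rw [h1, hNL]
    split_ifs
    · rw [hb]
    · rfl

end Block

/-- Splitting off all Jordan blocks of a given size. -/
theorem exists_similar_copies_prod {J : Type v} [AddCommGroup J] [Module k J] {h : End k J} {i : ℕ}
    (hi : 1 ≤ i) (hJ : IsBlock i h) {V : Type u} [AddCommGroup V] [Module k V]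
    [FiniteDimensional k V] {f : End k V} (hf : IsNilpotent (f - 1)) :
    ∃ (m : ℕ) (X : Type u) (_ : AddCommGroup X) (_ : Module k X) (fX : End k X),
      Similar f ((h.compLeft (Fin m)).prodMap fX) ∧ (m : ℤ) = blockMult i f := by
  induction hn : finrank k V using Nat.strong_induction_on generalizing V with
  | _ n ih =>
    rcases subsingleton_or_nontrivial V with hV | hV
    · exact ⟨0, V, _, _, f, similar_copies_zero h f, by simp [blockMult_of_subsingleton]⟩
    obtain ⟨U, U', hU, hU', hc, d, hd, hblock⟩ := exists_isCompl_isBlock hf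
    have hsim := similar_prod_restrict hU hU' hc
    obtain ⟨q, hq⟩ := hf
    have hq' := (pow_sub_one_eq_zero_of_prodMap (hsim.pow_sub_one_eq_zero hq)).2
    have hdim := Submodule.finrank_add_eq_of_isCompl hc
    obtain ⟨m, X, _, _, fX, hX, hm⟩ := ih (finrank k U')
      (by have := hblock.finrank_eq; omega) ⟨q, hq'⟩ rfl
    -- The block just split off joins the copies of `h` if it has size `i`, and the remainder
    -- otherwise.
    have hmult : blockMult i f = (if d = i then 1 else 0) + m := by
      rw [hsim.blockMult_eq, blockMult_prodMap, hblock.blockMult_eq hd hi, hm]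
    by_cases hdi : d = i
    · subst hdi
      refine ⟨m + 1, X, _, _, fX, ?_, by rw [hmult, if_pos rfl]; push_cast; ring⟩
      refine hsim.trans (((hblock.similar hJ).prodMap hX).trans ?_)
      exact (similar_prod_assoc _ _ _).symm.trans
        ((similar_copies_succ h m).prodMap (Similar.refl fX))
    · refine ⟨m, U × X, _, _, (f.restrict hU).prodMap fX, ?_, by rw [hmult, if_neg hdi, zero_add]⟩
      refine hsim.trans (((Similar.refl _).prodMap hX).trans ?_)
      exact (similar_prod_assoc _ _ _).symm.trans
        (((similar_prod_comm _ _).prodMap (Similar.refl _)).trans (similar_prod_assoc _ _ _))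

theorem blockMult_nonneg {J : Type v} [AddCommGroup J] [Module k J] {h : End k J} {i : ℕ}
    (hi : 1 ≤ i) (hJ : IsBlock i h) {V : Type u} [AddCommGroup V] [Module k V]
    [FiniteDimensional k V] {f : End k V} (hf : IsNilpotent (f - 1)) : 0 ≤ blockMult i f := by
  obtain ⟨m, -, -, -, -, -, hm⟩ := exists_similar_copies_prod hi hJ hf
  omega

/-! ### Tensoring with a block of size two -/

section TensorTwo

variable {V W : Type*} [AddCommGroup V] [Module k V] [AddCommGroup W] [Module k W]

/-- The endomorphism of `W × W` modelling the tensor product of `f` with a block of size two. -/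
def twist (f : End k W) : End k (W × W) :=
  LinearMap.prod (f ∘ₗ LinearMap.fst k W W) (f ∘ₗ LinearMap.snd k W W + f ∘ₗ LinearMap.fst k W W)

/-- Here `twist f - 1` is the diagonal action of `f - 1` plus the map `(x, y) ↦ (0, f x)`. The two
commute and the second squares to zero, so only two binomial terms survive. -/
theorem twist_sub_one_pow (f : End k W) (j : ℕ) (x : W × W) :
    ((twist f - 1) ^ (j + 1)) x = (((f - 1) ^ (j + 1)) x.1,
      ((f - 1) ^ (j + 1)) x.2 + ((j : k) + 1) • ((f - 1) ^ j) (f x.1)) := by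
  have hcomm (i : ℕ) (y : W) : ((f - 1) ^ i) (f y) = f (((f - 1) ^ i) y) := by
    have : Commute ((f - 1) ^ i) f := ((Commute.refl f).sub_left (Commute.one_left f)).pow_left i
    exact LinearMap.congr_fun this.eq y
  have hone (x : W × W) : (twist f - 1) x = ((f - 1) x.1, (f - 1) x.2 + f x.1) := by
    ext <;> simp [twist]
    abel
  induction j with
  | zero => simp [hone]
  | succ j ih =>
    rw [pow_succ', Module.End.mul_apply, ih, hone]
    refine Prod.ext ?_ ?_
    · simp only [pow_succ' _ (j + 1), Module.End.mul_apply]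
    · simp only [map_add, map_smul]
      rw [← Module.End.mul_apply, ← pow_succ', ← Module.End.mul_apply (f - 1), ← pow_succ',
        ← hcomm]
      push_cast
      module

theorem similar_twist {h : End k V} (hh : IsBlock 2 h) (f : End k W) :
    Similar (TensorProduct.map h f) (twist f) := by
  obtain ⟨b, hb⟩ := hh
  have h0 : h (b 0) = b 0 + b 1 := by
    have := hb 0
    rw [LinearMap.sub_apply, Module.End.one_apply, dif_pos (by simp), sub_eq_iff_eq_add'] at this
    exact this
  have h1 : h (b 1) = b 1 := by
    have := hb 1
    rw [LinearMap.sub_apply, Module.End.one_apply, dif_neg (by simp), sub_eq_zero] at this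
    exact this
  let e : V ⊗[k] W ≃ₗ[k] W × W :=
    TensorProduct.congr (b.equivFun ≪≫ₗ LinearEquiv.finTwoArrow k k) (LinearEquiv.refl k W) ≪≫ₗ
      TensorProduct.prodLeft k k k k W ≪≫ₗ
        (TensorProduct.lid k W).prodCongr (TensorProduct.lid k W)
  have e0 (y : W) : e (b 0 ⊗ₜ y) = (y, 0) := by
    simp [e, LinearEquiv.finTwoArrow]
  have e1 (y : W) : e (b 1 ⊗ₜ y) = (0, y) := by
    simp [e, LinearEquiv.finTwoArrow]
  refine ⟨e, fun x => ?_⟩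
  induction x with
  | zero => simp
  | add x y hx hy => simp only [map_add, hx, hy]
  | tmul x y =>
    rw [← b.sum_repr x, Fin.sum_univ_two]
    simp only [TensorProduct.add_tmul, map_add, TensorProduct.map_tmul, map_smul,
      ← TensorProduct.smul_tmul', h0, h1, e0, e1]
    simp [twist]

/-- The second kernel equation says that `(f - 1) ^ j` kills `(f - 1) x.2 + (j + 1) • f x.1`. Given
this, applying `f - 1` once more shows that the first equation is equivalent to `(f - 1) ^ (j + 2)`
killing `x.2`. The change of variables `E` takes these two vectors as coordinates; it is invertible
because `f` and `j + 1` are. -/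
theorem kerDim_twist [FiniteDimensional k W] {f : End k W} (hf : IsNilpotent (f - 1)) {j : ℕ}
    (hj : (j : k) + 1 ≠ 0) : kerDim (j + 1) (twist f) = kerDim (j + 2) f + kerDim j f := by
  have hfinj : Function.Injective f := by
    have : IsUnit f := by simpa using hf.isUnit_one_add
    exact ((Module.End.isUnit_iff f).1 this).injective
  have hcomm (i : ℕ) (y : W) : ((f - 1) ^ i) (f y) = f (((f - 1) ^ i) y) := by
    have : Commute ((f - 1) ^ i) f := ((Commute.refl f).sub_left (Commute.one_left f)).pow_left i
    exact LinearMap.congr_fun this.eq y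
  let E : End k (W × W) := LinearMap.prod (LinearMap.snd k W W)
    ((f - 1) ∘ₗ LinearMap.snd k W W + ((j : k) + 1) • (f ∘ₗ LinearMap.fst k W W))
  have hE (x : W × W) : E x = (x.2, (f - 1) x.2 + ((j : k) + 1) • f x.1) := rfl
  have hEinj : Function.Injective E := by
    rw [injective_iff_map_eq_zero]
    intro x hx
    rw [hE, Prod.mk_eq_zero] at hx
    obtain ⟨h2, h1⟩ := hx
    rw [h2, map_zero, zero_add, smul_eq_zero_iff_right hj] at h1
    exact Prod.ext (hfinj (by simpa using h1)) h2
  have hker : (LinearMap.ker ((twist f - 1) ^ (j + 1))).map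
      (LinearEquiv.ofInjectiveEndo E hEinj).toLinearMap =
      (LinearMap.ker ((f - 1) ^ (j + 2))).prod (LinearMap.ker ((f - 1) ^ j)) := by
    ext y
    obtain ⟨x, rfl⟩ := (LinearEquiv.ofInjectiveEndo E hEinj).surjective y
    rw [← LinearEquiv.coe_coe, Submodule.mem_map]
    simp only [LinearEquiv.coe_coe, EmbeddingLike.apply_eq_iff_eq, exists_eq_right]
    simp only [LinearEquiv.coe_ofInjectiveEndo, hE, Submodule.mem_prod,
      LinearMap.mem_ker, twist_sub_one_pow, Prod.mk_eq_zero, map_add, map_smul]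
    rw [← Module.End.mul_apply _ (f - 1), ← pow_succ]
    constructor
    · rintro ⟨h1, h2⟩
      refine ⟨?_, h2⟩
      have := congrArg ⇑(f - 1) h2
      rw [map_add, map_smul, ← Module.End.mul_apply, ← pow_succ',
        ← Module.End.mul_apply (f - 1) (_ ^ j), ← pow_succ', hcomm, h1, map_zero,
        smul_zero, add_zero, map_zero] at this
      exact this
    · rintro ⟨h1, h2⟩
      refine ⟨?_, h2⟩
      have := congrArg ⇑(f - 1) h2
      rw [map_add, map_smul, ← Module.End.mul_apply, ← pow_succ',
        ← Module.End.mul_apply (f - 1) (_ ^ j), ← pow_succ', hcomm, h1, zero_add,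
        map_zero, smul_eq_zero_iff_right hj] at this
      exact hfinj (by rw [this, map_zero])
  rw [kerDim, ((LinearEquiv.ofInjectiveEndo E hEinj).ofSubmodules _ _ hker).finrank_eq, kerDim,
    kerDim, finrank_submodule_prod]

end TensorTwo

end UnipotentBlock

namespace UnipotentBlock

open Module TensorProduct

universe u v w

/-! ### Endomorphisms of order dividing `p` and the Clebsch–Gordan rule -/

section Unipotent

variable {k : Type w} [Field k] {V W : Type*} [AddCommGroup V] [Module k V] [AddCommGroup W]
  [Module k W] {p : ℕ}

/-- Frobenius: `(f - 1) ^ p = f ^ p - 1` in characteristic `p`. -/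
theorem sub_one_pow_eq_zero [hp : Fact p.Prime] [CharP k p] {f : End k V} (hf : f ^ p = 1) :
    (f - 1) ^ p = 0 := by
  rcases subsingleton_or_nontrivial V with hV | hV
  · exact Subsingleton.elim _ _
  · have : CharP (End k V) p :=
      charP_of_injective_algebraMap (FaithfulSMul.algebraMap_injective k (End k V)) p
    rw [sub_pow_char_of_commute p (Commute.one_right f), hf, one_pow, sub_self]

theorem tensorMap_pow_eq_one {f : End k V} {g : End k W} (hf : f ^ p = 1) (hg : g ^ p = 1) :
    (TensorProduct.map f g) ^ p = 1 := by
  rw [TensorProduct.map_pow, hf, hg, TensorProduct.map_one]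

theorem kerDim_of_le {f : End k V} {i j : ℕ} (h : (f - 1) ^ i = 0) (hij : i ≤ j) :
    kerDim j f = finrank k V :=
  kerDim_of_pow_eq_zero (pow_eq_zero_of_le hij h)

theorem natCast_add_one_ne_zero [CharP k p] {j : ℕ} (hj : j + 1 < p) : (j : k) + 1 ≠ 0 := by
  intro h
  have : ((j + 1 : ℕ) : k) = 0 := by exact_mod_cast h
  rw [CharP.cast_eq_zero_iff k p] at this
  exact absurd (Nat.le_of_dvd (by omega) this) (by omega)

theorem kerDim_tensor_two [hp : Fact p.Prime] [CharP k p] [FiniteDimensional k W] {h : End k V}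
    (hh : IsBlock 2 h) {f : End k W} (hf : f ^ p = 1) {j : ℕ} (hj : j + 1 < p) :
    kerDim (j + 1) (TensorProduct.map h f) = kerDim (j + 2) f + kerDim j f := by
  rw [(similar_twist hh f).kerDim_eq,
    kerDim_twist ⟨p, sub_one_pow_eq_zero hf⟩ (natCast_add_one_ne_zero hj)]

theorem kerDim_one_pos [FiniteDimensional k V] [Nontrivial V] {f : End k V}
    (hz : (f - 1) ^ p = 0) : 0 < kerDim 1 f := by
  obtain ⟨U, U', hU, hU', hc, d, hd, hblock⟩ := exists_isCompl_isBlock ⟨p, hz⟩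
  rw [(similar_prod_restrict hU hU' hc).kerDim_eq, kerDim_prodMap, hblock.kerDim_eq]
  omega

/-- A unipotent endomorphism with the kernel dimensions of a sum of blocks of sizes `l` and `l + 2`
is such a sum. -/
theorem similar_prod_of_kerDim {X Y : Type*} [AddCommGroup X] [Module k X] [AddCommGroup Y]
    [Module k Y] [FiniteDimensional k V] {f : End k V} (hz : (f - 1) ^ p = 0) {l : ℕ} (hl : 1 ≤ l)
    (hdim : finrank k V = 2 * (l + 1)) (k1 : kerDim 1 f = 2) (kl : kerDim (l + 1) f = 2 * l + 1)
    {x : End k X} {y : End k Y} (hx : IsBlock l x) (hy : IsBlock (l + 2) y) :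
    Similar f (x.prodMap y) := by
  have : Nontrivial V := nontrivial_of_finrank_pos (R := k) (by omega)
  obtain ⟨U, U', hU, hU', hc, d, hd, hblock⟩ := exists_isCompl_isBlock ⟨p, hz⟩
  have hsim := similar_prod_restrict hU hU' hc
  have hz' := (pow_sub_one_eq_zero_of_prodMap (hsim.pow_sub_one_eq_zero hz)).2
  have h1 := Submodule.finrank_add_eq_of_isCompl hc
  rw [hblock.finrank_eq] at h1
  rw [hsim.kerDim_eq, kerDim_prodMap, hblock.kerDim_eq] at k1 kl
  generalize hg : f.restrict hU' = g at *
  have : Nontrivial U' := by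
    by_contra hn
    rw [not_nontrivial_iff_subsingleton] at hn
    have : kerDim 1 g = 0 := finrank_zero_of_subsingleton
    omega
  obtain ⟨T, T', hT, hT', hc', d', hd', hblock'⟩ := exists_isCompl_isBlock ⟨p, hz'⟩
  have hsim' := similar_prod_restrict hT hT' hc'
  have hz'' := (pow_sub_one_eq_zero_of_prodMap (hsim'.pow_sub_one_eq_zero hz')).2
  have h2 := Submodule.finrank_add_eq_of_isCompl hc'
  rw [hsim'.kerDim_eq, kerDim_prodMap, hblock'.kerDim_eq] at k1 kl
  -- `kerDim 1` counts blocks, so a third summand would push it above `2`.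
  have : Subsingleton T' := by
    by_contra hn
    rw [not_subsingleton_iff_nontrivial] at hn
    have := kerDim_one_pos hz''
    omega
  let _ : Unique T' := uniqueOfSubsingleton 0
  have kT : kerDim (l + 1) (g.restrict hT') = 0 := finrank_zero_of_subsingleton
  rw [hblock'.finrank_eq, finrank_zero_of_subsingleton (M := T')] at h2
  rw [kT] at kl
  have hT0 : Similar ((g.restrict hT).prodMap (g.restrict hT')) (g.restrict hT) :=
    ⟨LinearEquiv.prodUnique (R := k) (M := T) (M₂ := T'), fun _ => rfl⟩
  have key := hsim.trans ((Similar.refl _).prodMap (hsim'.trans hT0))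
  -- The sizes add up to `2 * (l + 1)`, and `kl` says that exactly one dimension survives `(f - 1) ^
  -- (l + 1)`, so the larger block has size `l + 2`.
  have hcase : (d = l ∧ d' = l + 2) ∨ (d = l + 2 ∧ d' = l) := by omega
  rcases hcase with ⟨rfl, rfl⟩ | ⟨rfl, rfl⟩
  · exact key.trans ((hblock.similar hx).prodMap (hblock'.similar hy))
  · exact key.trans (((hblock.similar hy).prodMap (hblock'.similar hx)).trans
      (similar_prod_comm _ _))

/-- The Clebsch-Gordan rule for a factor of dimension two, below the characteristic. -/
theorem similar_tensor_two [hp : Fact p.Prime] [CharP k p] {X Y : Type*} [AddCommGroup X]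
    [Module k X] [AddCommGroup Y] [Module k Y] {h : End k V} (hh : IsBlock 2 h) (hhp : h ^ p = 1)
    {l : ℕ} (hl : 1 ≤ l) (hlp : l + 2 ≤ p) {f : End k W} (hf : IsBlock (l + 1) f)
    (hfp : f ^ p = 1) {x : End k X} {y : End k Y} (hx : IsBlock l x) (hy : IsBlock (l + 2) y) :
    Similar (TensorProduct.map h f) (x.prodMap y) := by
  have := hh.finiteDimensional
  have := hf.finiteDimensional
  refine similar_prod_of_kerDim (sub_one_pow_eq_zero (tensorMap_pow_eq_one hhp hfp)) hl ?_ ?_ ?_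
    hx hy
  · rw [finrank_tensorProduct, hh.finrank_eq, hf.finrank_eq]
  · rw [kerDim_tensor_two hh hfp (by omega), hf.kerDim_eq, hf.kerDim_eq]
    omega
  · rw [kerDim_tensor_two hh hfp (by omega), hf.kerDim_eq, hf.kerDim_eq]
    omega

theorem isBlock_one : IsBlock 1 (1 : End k k) :=
  ⟨Basis.singleton (Fin 1) k, fun a => by simp⟩

theorem similar_tensor_one {h : End k V} (hh : IsBlock 1 h) (f : End k W) :
    Similar (TensorProduct.map h f) f := by
  refine ((hh.similar isBlock_one).tensorMap (Similar.refl f)).trans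
    ⟨TensorProduct.lid k W, fun x => ?_⟩
  induction x with
  | zero => simp
  | add x y hx hy => simp only [map_add, hx, hy]
  | tmul x y => simp

end Unipotent

/-! ### Characters of the Green ring -/

/-- The values `a i` of a character of the Green ring of the cyclic group of order `p` on the
indecomposables of dimension `i`, with value `t` in dimension two. -/
structure IsGreenChar (p : ℕ) (t : ℂ) (a : ℕ → ℂ) : Prop where
  zero : a 0 = 0
  one : a 1 = 1
  step : ∀ i, a (i + 2) = t * a (i + 1) - a i
  -- This encodes `V_2 ⊗ V_p = V_p ⊕ V_p`, where the recursion stops describing tensor products.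
  top : (2 - t) * a p = 0

/-- The linear extension of `a` to all unipotent endomorphisms. -/
noncomputable def greenChar {k : Type*} [Field k] {V : Type*} [AddCommGroup V] [Module k V] (p : ℕ)
    (a : ℕ → ℂ) (f : End k V) : ℂ :=
  ∑ i ∈ Finset.range p, (blockMult (i + 1) f : ℂ) * a (i + 1)

section SumByParts

variable {p : ℕ} {t : ℂ} {a : ℕ → ℂ} (ha : IsGreenChar p t a)

include ha

/-- Summation by parts: the second difference moves from `K` to `a`, where the recursion turns it
into the factor `2 - t`. -/
theorem IsGreenChar.sum_second_difference (K : ℕ → ℂ) (n : ℕ) :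
    ∑ i ∈ Finset.range n, (2 * K (i + 1) - K i - K (i + 2)) * a (i + 1) =
      (2 - t) * ∑ i ∈ Finset.range n, K (i + 1) * a (i + 1) - K 0 + K n * a (n + 1) -
        K (n + 1) * a n := by
  induction n with
  | zero => simp [ha.zero, ha.one]
  | succ n ih =>
    rw [Finset.sum_range_succ, Finset.sum_range_succ, ih, ha.step]
    ring

theorem IsGreenChar.sum_shift (K : ℕ → ℂ) (n : ℕ) :
    ∑ i ∈ Finset.range n, (K (i + 2) + K i) * a (i + 1) =
      t * ∑ i ∈ Finset.range n, K (i + 1) * a (i + 1) + K 0 - K n * a (n + 1) +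
        K (n + 1) * a n := by
  induction n with
  | zero => simp [ha.zero, ha.one]
  | succ n ih =>
    rw [Finset.sum_range_succ, Finset.sum_range_succ, ih, ha.step]
    ring

/-- `K` and `L` stand for the kernel dimensions on `W` and on `V_2 ⊗ W`. The rule `L (i + 1) = K (i
+ 2) + K i` is available only below `p`; from `p` on both kernels are everything. -/
theorem IsGreenChar.sum_tensor_two {q : ℕ} (hq : p = q + 1) {K L : ℕ → ℂ} (hK0 : K 0 = 0)
    (hL0 : L 0 = 0) (hK : K (p + 1) = K p) (hL : ∀ i < q, L (i + 1) = K (i + 2) + K i)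
    (hLp : L p = 2 * K p) (hLp' : L (p + 1) = 2 * K p) :
    ∑ i ∈ Finset.range p, (2 * L (i + 1) - L i - L (i + 2)) * a (i + 1) =
      t * ∑ i ∈ Finset.range p, (2 * K (i + 1) - K i - K (i + 2)) * a (i + 1) := by
  subst hq
  have hsum : ∑ i ∈ Finset.range q, L (i + 1) * a (i + 1) =
      ∑ i ∈ Finset.range q, (K (i + 2) + K i) * a (i + 1) :=
    Finset.sum_congr rfl fun i hi => by rw [hL i (Finset.mem_range.1 hi)]
  rw [ha.sum_second_difference, ha.sum_second_difference, Finset.sum_range_succ,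
    Finset.sum_range_succ, hsum, ha.sum_shift, hLp, hLp', hK0, hL0, hK]
  have h1 := ha.top
  have h2 := ha.step q
  rw [h2]
  -- The boundary terms leave only a multiple of `(2 - t) * a p`.
  linear_combination (K (q + 1) - K q) * h1

end SumByParts

section Character

variable {k : Type w} [Field k] {V W : Type*} [AddCommGroup V] [Module k V] [AddCommGroup W]
  [Module k W] {p : ℕ} {t : ℂ} {a : ℕ → ℂ}

theorem Similar.greenChar_eq {f : End k V} {g : End k W} (h : Similar f g) :
    greenChar p a f = greenChar p a g := by
  simp [greenChar, h.blockMult_eq]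

theorem greenChar_prodMap [FiniteDimensional k V] [FiniteDimensional k W] (f : End k V)
    (g : End k W) : greenChar p a (f.prodMap g) = greenChar p a f + greenChar p a g := by
  simp only [greenChar, blockMult_prodMap, Int.cast_add, add_mul, Finset.sum_add_distrib]

theorem IsBlock.greenChar_eq {d : ℕ} {f : End k V} (hf : IsBlock d f) (hd : 1 ≤ d) (hdp : d ≤ p) :
    greenChar p a f = a d := by
  rw [greenChar, Finset.sum_eq_single (d - 1)]
  · rw [hf.blockMult_eq hd (by omega), if_pos (by omega)]
    rw [Nat.sub_add_cancel hd]
    simp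
  · intro i _ hi
    rw [hf.blockMult_eq hd (by omega), if_neg (by omega)]
    simp
  · intro h
    exact absurd (Finset.mem_range.2 (by omega)) h

theorem greenChar_tensor_two [hp : Fact p.Prime] [CharP k p] [FiniteDimensional k W]
    (ha : IsGreenChar p t a) {h : End k V} (hh : IsBlock 2 h) (hhp : h ^ p = 1) {f : End k W}
    (hf : f ^ p = 1) : greenChar p a (TensorProduct.map h f) = t * greenChar p a f := by
  have := hh.finiteDimensional
  have hz := sub_one_pow_eq_zero (k := k) (tensorMap_pow_eq_one hhp hf)
  have hz' := sub_one_pow_eq_zero (k := k) hf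
  have hdim : finrank k (V ⊗[k] W) = 2 * finrank k W := by
    rw [finrank_tensorProduct, hh.finrank_eq]
  have key := ha.sum_tensor_two (q := p - 1) (by have := hp.out.pos; omega)
    (K := fun i => (kerDim i f : ℂ)) (L := fun i => (kerDim i (TensorProduct.map h f) : ℂ))
    (by simp [kerDim_zero]) (by simp [kerDim_zero])
    (by simp only [kerDim_of_le hz' le_rfl, kerDim_of_le hz' (Nat.le_succ p)])
    (fun i hi => by
      simp only [kerDim_tensor_two hh hf (show i + 1 < p by omega), Nat.cast_add])
    (by simp only [kerDim_of_le hz' le_rfl, kerDim_of_le hz le_rfl, hdim]; push_cast; rfl)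
    (by simp only [kerDim_of_le hz' le_rfl, kerDim_of_le hz (Nat.le_succ p), hdim]
        push_cast; rfl)
  simpa [greenChar, blockMult] using key

/-- Evaluate `V_2 ⊗ V_{l+2} ⊗ W` in two ways: as `t` times the value on `V_{l+2} ⊗ W`, and through
`V_{l+1} ⊕ V_{l+3}`. The value on `V_{l+3} ⊗ W` then obeys the recursion of `a`. -/
theorem greenChar_tensor [hp : Fact p.Prime] [CharP k p] [FiniteDimensional k W]
    (ha : IsGreenChar p t a) (hp2 : 2 ≤ p) {B : ℕ → Type v} [∀ i, AddCommGroup (B i)]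
    [∀ i, Module k (B i)] {b : ∀ i, End k (B i)} (hb : ∀ i, 1 ≤ i → i ≤ p → IsBlock i (b i))
    (hbp : ∀ i, (b i) ^ p = 1) {f : End k W} (hf : f ^ p = 1) {l : ℕ} (hl : 1 ≤ l) (hlp : l ≤ p) :
    greenChar p a (TensorProduct.map (b l) f) = a l * greenChar p a f := by
  induction l using Nat.strong_induction_on with
  | _ l ih =>
    match l, hl with
    | 1, _ => rw [(similar_tensor_one (hb 1 le_rfl hlp) f).greenChar_eq, ha.one, one_mul]
    | 2, _ =>
      rw [greenChar_tensor_two ha (hb 2 (by omega) hlp) (hbp 2) hf, ha.step 0, ha.zero, zero_add,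
        ha.one, mul_one, sub_zero]
    | l + 3, _ =>
      have := (hb (l + 1) (by omega) (by omega)).finiteDimensional
      have := (hb (l + 2) (by omega) (by omega)).finiteDimensional
      have := (hb (l + 3) (by omega) (by omega)).finiteDimensional
      have h1 := similar_tensor_two (hb 2 (by omega) hp2) (hbp 2) (l := l + 1) (by omega)
        (by omega) (hb (l + 2) (by omega) (by omega)) (hbp (l + 2))
        (hb (l + 1) (by omega) (by omega)) (hb (l + 3) (by omega) (by omega))
      have h2 := ((similar_tensor_assoc (b 2) (b (l + 2)) f).symm.trans
        ((h1.tensorMap (Similar.refl f)).trans (similar_prod_tensor _ _ _))).greenChar_eq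
          (p := p) (a := a)
      rw [greenChar_prodMap, greenChar_tensor_two ha (hb 2 (by omega) hp2) (hbp 2)
        (tensorMap_pow_eq_one (hbp _) hf), ih (l + 2) (by omega) (by omega) (by omega),
        ih (l + 1) (by omega) (by omega) (by omega)] at h2
      rw [ha.step (l + 1)]
      linear_combination -h2

end Character

end UnipotentBlock

namespace UnipotentBlock

open Module TensorProduct

universe u v w

/-! ### From representations of a cyclic group to one endomorphism -/

section Representation

variable {k G : Type*} [Field k] [Group G] {V : Type u} {W : Type v} [AddCommGroup V] [Module k V]
  [AddCommGroup W] [Module k W] {g : G}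

theorem isCompl_toSubmodule_iff {ρ : Representation k G V} {U U' : Subrepresentation ρ} :
    IsCompl U.toSubmodule U'.toSubmodule ↔ IsCompl U U' := by
  simp only [isCompl_iff, disjoint_iff, codisjoint_iff,
    ← Subrepresentation.toSubmodule_injective.eq_iff]
  rfl

theorem intertwines_of_generator (hg : ∀ x : G, ∃ n : ℕ, g ^ n = x) {ρ : Representation k G V}
    {σ : Representation k G W} {φ : V →ₗ[k] W} (h : ∀ y, φ (ρ g y) = σ g (φ y)) (x : G) :
    φ ∘ₗ ρ x = σ x ∘ₗ φ := by
  obtain ⟨n, rfl⟩ := hg x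
  ext y
  rw [LinearMap.comp_apply, LinearMap.comp_apply]
  induction n generalizing y with
  | zero => simp
  | succ n ih => rw [pow_succ, map_mul, map_mul, Module.End.mul_apply, ih, h, Module.End.mul_apply]

/-- A subspace invariant under a generator is a subrepresentation. -/
def subrepresentationOfGenerator (hg : ∀ x : G, ∃ n : ℕ, g ^ n = x) {ρ : Representation k G V}
    (U : Submodule k V) (hU : ∀ y ∈ U, ρ g y ∈ U) : Subrepresentation ρ where
  toSubmodule := U
  apply_mem_toSubmodule x y hy := by
    obtain ⟨n, rfl⟩ := hg x
    induction n generalizing y with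
    | zero => simpa using hy
    | succ n ih =>
      rw [pow_succ, map_mul, Module.End.mul_apply]
      exact ih _ (hU _ hy)

/-- Subspaces invariant under a generator are subrepresentations, so the block that splits off must
be the whole space. -/
theorem isBlock_of_isIndecomposable (hg : ∀ x : G, ∃ n : ℕ, g ^ n = x) [FiniteDimensional k V]
    {ρ : Representation k G V} (hρ : ρ.IsIndecomposable) (hz : IsNilpotent (ρ g - 1)) :
    IsBlock (finrank k V) (ρ g) := by
  obtain ⟨hV, hdec⟩ := hρ
  obtain ⟨U, U', hU, hU', hc, d, hd, hblock⟩ := exists_isCompl_isBlock hz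
  rcases hdec (subrepresentationOfGenerator hg U hU) (subrepresentationOfGenerator hg U' hU')
    (isCompl_toSubmodule_iff.1 hc) with h | h
  · have h0 : U = ⊥ := congrArg Subrepresentation.toSubmodule h
    have := hblock.finrank_eq
    rw [h0, finrank_bot] at this
    omega
  · have h0 : U' = ⊥ := congrArg Subrepresentation.toSubmodule h
    subst h0
    have htop : U = ⊤ := by simpa using hc.sup_eq_top
    subst htop
    have hd' : finrank k V = d := by rw [← hblock.finrank_eq, finrank_top]
    rw [hd']
    obtain ⟨b, hb⟩ := hblock
    refine ⟨b.map Submodule.topEquiv, fun a => ?_⟩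
    have h1 := congrArg Subtype.val (hb a)
    have h2 : (ρ g - 1) ((b.map Submodule.topEquiv) a) =
        (((ρ g).restrict hU - 1 : End k (⊤ : Submodule k V)) (b a)).1 := by simp
    rw [h2, h1]
    split_ifs <;> simp

theorem similar_of_equiv {ρ : Representation k G V} {σ : Representation k G W} (e : ρ.Equiv σ)
    (x : G) : Similar (ρ x) (σ x) :=
  ⟨e.toLinearEquiv, fun y => LinearMap.congr_fun (e.isIntertwining' x) y⟩

theorem similar_directSum (σ : Representation k G W) (m : ℕ) (x : G) :
    Similar ((σ x).compLeft (Fin m)) (Representation.directSum (fun _ : Fin m => σ) x) := by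
  apply Similar.symm
  refine ⟨DirectSum.linearEquivFunOnFintype k (Fin m) (fun _ => W), fun y => ?_⟩
  rfl

/-- Splitting off all blocks of size `i` attains `blockMult i`. Conversely, `m'` copies contribute
`m'` to `blockMult i`, and the complement contributes a nonnegative amount, so no larger number
occurs. -/
theorem summandMultiplicity_eq (hg : ∀ x : G, ∃ n : ℕ, g ^ n = x) [FiniteDimensional k V]
    {ρ : Representation k G V} {σ : Representation k G W} {i : ℕ} (hi : 1 ≤ i)
    (hσ : IsBlock i (σ g)) (hz : IsNilpotent (ρ g - 1)) :
    (σ.summandMultiplicity ρ : ℤ) = blockMult i (ρ g) := by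
  have := hσ.finiteDimensional
  obtain ⟨m, X, _, _, fX, hsim, hm⟩ := exists_similar_copies_prod hi hσ hz
  rw [← hm, Nat.cast_inj]
  refine IsGreatest.csSup_eq ⟨?_, ?_⟩
  · obtain ⟨e, he⟩ := hsim.symm
    obtain ⟨s, hs⟩ := (similar_directSum σ m g).symm
    let L := e.toLinearMap ∘ₗ LinearMap.inl k (Fin m → W) X
    let R := e.toLinearMap ∘ₗ LinearMap.inr k (Fin m → W) X
    have hL (y : Fin m → W) : ρ g (L y) = L ((σ g).compLeft (Fin m) y) := by
      simp [L, ← he]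
    have hR (y : X) : ρ g (R y) = R (fX y) := by
      simp [R, ← he]
    have hLinj : Function.Injective L := e.injective.comp LinearMap.inl_injective
    have hc : IsCompl (LinearMap.range L) (LinearMap.range R) := by
      rw [LinearMap.range_comp, LinearMap.range_comp]
      exact (LinearMap.isCompl_range_inl_inr (R := k) (M := Fin m → W) (M₂ := X)).map
        (Submodule.orderIsoMapComap e)
    refine ⟨subrepresentationOfGenerator hg (LinearMap.range L) ?_,
      subrepresentationOfGenerator hg (LinearMap.range R) ?_, isCompl_toSubmodule_iff.1 hc, ⟨?_⟩⟩
    · rintro _ ⟨y, rfl⟩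
      exact ⟨_, (hL y).symm⟩
    · rintro _ ⟨y, rfl⟩
      exact ⟨_, (hR y).symm⟩
    · refine Representation.Equiv.mk (s ≪≫ₗ LinearEquiv.ofInjective L hLinj) fun x =>
        intertwines_of_generator hg (fun y => ?_) x
      apply Subtype.ext
      exact (congrArg L (hs y)).trans (hL (s y)).symm
  · rintro m' ⟨U, U', hc, ⟨e⟩⟩
    have hsim' := similar_prod_restrict (f := ρ g) (U.apply_mem_toSubmodule g)
      (U'.apply_mem_toSubmodule g) (isCompl_toSubmodule_iff.2 hc)
    obtain ⟨q, hq⟩ := hz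
    have hq' := (pow_sub_one_eq_zero_of_prodMap (hsim'.pow_sub_one_eq_zero hq)).2
    have h0 := blockMult_nonneg hi hσ ⟨q, hq'⟩
    have h1 := ((similar_directSum σ m' g).trans (similar_of_equiv e g)).blockMult_eq i
    rw [blockMult_copies, hσ.blockMult_eq hi hi, if_pos rfl, mul_one] at h1
    have h2 := hsim'.blockMult_eq i
    rw [blockMult_prodMap, ← hm] at h2
    change (m : ℤ) = blockMult i (U.toRepresentation g) + _ at h2
    omega

end Representation

/-! ### Simultaneous diagonalisation of the action matrices -/

section Matrix

variable {k G : Type*} [Field k] [Group G] {p : ℕ} {V : ℕ → Type v}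
  [∀ i, AddCommGroup (V i)] [∀ i, Module k (V i)]

/-- A character of the Green ring is a left eigenvector of every action matrix. -/
theorem sum_greenChar_mul_actionMatrix (hp : p.Prime) [CharP k p] (hG : Nat.card G = p)
    [IsCyclic G] {ρ : ∀ i, Representation k G (V i)}
    (hdim : ∀ i, 1 ≤ i → i ≤ p → Module.finrank k (V i) = i)
    (hind : ∀ i, 1 ≤ i → i ≤ p → (ρ i).IsIndecomposable) {t : ℂ} {a : ℕ → ℂ}
    (ha : IsGreenChar p t a) {l : ℕ} (hl : 1 ≤ l) (hlp : l ≤ p) (j : Finset.Icc 1 p) :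
    ∑ i : Finset.Icc 1 p, a i * actionMatrix (ρ l) p ρ i j = a l * a j := by
  have : Fact p.Prime := ⟨hp⟩
  have : Finite G := Nat.finite_of_card_ne_zero (by rw [hG]; exact hp.ne_zero)
  obtain ⟨g, hgen⟩ := IsCyclic.exists_generator (α := G)
  have hg : ∀ x : G, ∃ n : ℕ, g ^ n = x := fun x => by
    have := hgen x
    rwa [← mem_powers_iff_mem_zpowers] at this
  have hpow (i : ℕ) : (ρ i g) ^ p = 1 := by
    rw [← map_pow, ← hG, pow_card_eq_one', map_one]
  have hfin (i : ℕ) (h1 : 1 ≤ i) (h2 : i ≤ p) : FiniteDimensional k (V i) :=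
    Module.finite_of_finrank_pos (by rw [hdim i h1 h2]; omega)
  have hb (i : ℕ) (h1 : 1 ≤ i) (h2 : i ≤ p) : IsBlock i (ρ i g) := by
    have := hfin i h1 h2
    have := isBlock_of_isIndecomposable hg (hind i h1 h2) ⟨p, sub_one_pow_eq_zero (hpow i)⟩
    rwa [hdim i h1 h2] at this
  obtain ⟨j, hj⟩ := j
  obtain ⟨hj1, hjp⟩ := Finset.mem_Icc.1 hj
  have := hfin j hj1 hjp
  have := hfin l hl hlp
  have hmult (i : ℕ) (h1 : 1 ≤ i) (h2 : i ≤ p) :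
      ((ρ i).summandMultiplicity ((ρ l).tprod (ρ j)) : ℂ) =
        (blockMult i (TensorProduct.map (ρ l g) (ρ j g)) : ℂ) := by
    rw [← Representation.tprod_apply, ← summandMultiplicity_eq hg h1 (hb i h1 h2)
      (ρ := (ρ l).tprod (ρ j))
      ⟨p, sub_one_pow_eq_zero (tensorMap_pow_eq_one (hpow l) (hpow j))⟩]
    simp
  have key := greenChar_tensor ha hp.two_le (b := fun i => ρ i g) hb hpow (hpow j) hl hlp
  rw [(hb j hj1 hjp).greenChar_eq hj1 hjp] at key
  rw [← key, greenChar]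
  simp only [actionMatrix]
  rw [Finset.sum_coe_sort (Finset.Icc 1 p) (fun i => a i *
    ((ρ i).summandMultiplicity ((ρ l).tprod (ρ j)) : ℂ)), ← Finset.Ico_succ_right_eq_Icc,
    Finset.sum_Ico_eq_sum_range]
  refine Finset.sum_congr (by simp) fun i hi => ?_
  have hi' : i < p := by simpa using hi
  rw [add_comm 1 i, hmult (i + 1) (by omega) (by omega), mul_comm]

/-- An action matrix is diagonalised by the characters of the Green ring. -/
theorem charpoly_actionMatrix (hp : p.Prime) [CharP k p] (hG : Nat.card G = p)
    [IsCyclic G] {ρ : ∀ i, Representation k G (V i)}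
    (hdim : ∀ i, 1 ≤ i → i ≤ p → Module.finrank k (V i) = i)
    (hind : ∀ i, 1 ≤ i → i ≤ p → (ρ i).IsIndecomposable) {t : ℕ → ℂ} {a : ℕ → ℕ → ℂ}
    (ha : ∀ s < p, IsGreenChar p (t s) (a s)) (ht : ∀ s < p, ∀ s' < p, t s = t s' → s = s')
    {l : ℕ} (hl : 1 ≤ l) (hlp : l ≤ p) :
    (actionMatrix (ρ l) p ρ).charpoly.roots = (Multiset.range p).map (fun s => a s l) := by
  -- Characters are numbered from `0` to `p - 1`, matrix rows from `1` to `p`.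
  let c : Finset.Icc 1 p → ℕ := fun s => s - 1
  have hc (s) : c s < p := by
    have := Finset.mem_Icc.1 s.2
    dsimp [c]
    omega
  have hcinj : Function.Injective c := fun s s' h => by
    have := Finset.mem_Icc.1 s.2
    have := Finset.mem_Icc.1 s'.2
    dsimp [c] at h
    ext
    omega
  let Q : Matrix (Finset.Icc 1 p) (Finset.Icc 1 p) ℂ := Matrix.of fun s i => a (c s) i
  have hQ {l : ℕ} (hl : 1 ≤ l) (hlp : l ≤ p) : Q * actionMatrix (ρ l) p ρ =
      Matrix.diagonal (fun s => a (c s) l) * Q := by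
    ext s j
    rw [Matrix.mul_apply, Matrix.diagonal_mul]
    exact sum_greenChar_mul_actionMatrix hp hG hdim hind (ha _ (hc s)) hl hlp j
  -- The rows of `Q` are eigenvectors of the transpose of `M_2` for the distinct eigenvalues `a 2 =
  -- t`; they are nonzero since their first entry is `a 1 = 1`.
  have hunit : IsUnit Q := by
    rw [← Matrix.linearIndependent_rows_iff_isUnit]
    refine Module.End.eigenvectors_linearIndependent'
      (Matrix.toLin' (actionMatrix (ρ 2) p ρ).transpose) (fun s => t (c s)) ?_ _ fun s => ⟨?_, ?_⟩
    · exact fun s s' h => hcinj (ht _ (hc s) _ (hc s') h)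
    · have h2 := hQ one_le_two hp.two_le
      rw [Module.End.mem_eigenspace_iff]
      ext j
      have h3 := congrFun (congrFun h2 s) j
      have h4 : a (c s) 2 = t (c s) := by
        rw [(ha _ (hc s)).step 0, (ha _ (hc s)).zero, zero_add, (ha _ (hc s)).one, mul_one,
          sub_zero]
      rw [Matrix.mul_apply, Matrix.diagonal_mul, h4] at h3
      rw [Matrix.toLin'_apply, Matrix.mulVec, dotProduct]
      simp only [Matrix.transpose_apply, mul_comm (actionMatrix _ _ _ _ _)]
      exact h3
    · intro h0
      have := congrFun h0 ⟨1, Finset.mem_Icc.2 ⟨le_rfl, hp.one_le⟩⟩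
      exact one_ne_zero ((ha _ (hc s)).one.symm.trans this)
  obtain ⟨q, hq⟩ := hunit
  have hconj : actionMatrix (ρ l) p ρ =
      q⁻¹.val * Matrix.diagonal (fun s => a (c s) l) * q.val := by
    rw [mul_assoc, hq, ← hQ hl hlp, ← hq, ← mul_assoc, Units.inv_mul, one_mul]
  rw [hconj, Matrix.coe_units_inv, Matrix.charpoly_units_conj', Matrix.charpoly_diagonal,
    Finset.prod_eq_multiset_prod]
  have : (Finset.univ.val.map fun s : Finset.Icc 1 p =>
      (Polynomial.X - Polynomial.C (a (c s) l) : Polynomial ℂ)) =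
      ((Finset.univ.val.map fun s : Finset.Icc 1 p => a (c s) l).map
        fun z => Polynomial.X - Polynomial.C z) := by
    rw [Multiset.map_map]
    rfl
  rw [this, Polynomial.roots_multiset_prod_X_sub_C]
  have hr : (Finset.univ.val.map c : Multiset ℕ) = Multiset.range p := by
    have h1 : (Finset.univ.map ⟨c, hcinj⟩ : Finset ℕ) = Finset.range p := by
      ext s
      simp only [Finset.mem_map, Finset.mem_univ, true_and, Function.Embedding.coeFn_mk,
        Finset.mem_range]
      constructor
      · rintro ⟨x, rfl⟩
        exact hc x
      · exact fun hs => ⟨⟨s + 1, Finset.mem_Icc.2 ⟨by omega, by omega⟩⟩, rfl⟩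
    exact congrArg Finset.val h1
  rw [← hr, Multiset.map_map]
  rfl

end Matrix

end UnipotentBlock

namespace UnipotentBlock

open Real

/-! ### Explicit characters as sine quotients -/

/-- The eigenvalues of the action matrix of the indecomposable of dimension `i`, indexed by
`s < p`. -/
noncomputable def greenValue (p s i : ℕ) : ℝ :=
  if s = 0 then i else sin (i * (s * π / p)) / sin (s * π / p)

section GreenValue

variable {p : ℕ}

theorem angle_pos {s : ℕ} (hs : 0 < s) (hsp : s < p) : 0 < s * π / p := by
  have : (0 : ℝ) < s := by exact_mod_cast hs
  have : (0 : ℝ) < p := by exact_mod_cast (by omega : 0 < p)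
  positivity

theorem angle_lt_pi {s : ℕ} (hsp : s < p) : s * π / p < π := by
  have h1 : (s : ℝ) < p := by exact_mod_cast hsp
  have h2 : (0 : ℝ) < p := lt_of_le_of_lt (Nat.cast_nonneg s) h1
  rw [div_lt_iff₀ h2, mul_comm π]
  exact mul_lt_mul_of_pos_right h1 pi_pos

theorem sin_angle_pos {s : ℕ} (hs : 0 < s) (hsp : s < p) : 0 < sin (s * π / p) :=
  sin_pos_of_pos_of_lt_pi (angle_pos hs hsp) (angle_lt_pi hsp)

/-- For `s = 0` this is the dimension, with `t = 2`. Otherwise the recursion is the addition formula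
for sine, and the value at `p` vanishes because `sin (s π) = 0`. -/
theorem isGreenChar_greenValue {s : ℕ} (hsp : s < p) :
    IsGreenChar p ((2 * cos (s * π / p) : ℝ) : ℂ) (fun i => (greenValue p s i : ℂ)) := by
  have hp0 : (p : ℝ) ≠ 0 := by exact_mod_cast (by omega : p ≠ 0)
  rcases Nat.eq_zero_or_pos s with rfl | hs
  · constructor
    · simp [greenValue]
    · simp [greenValue]
    · intro i
      simp [greenValue]
      ring
    · simp
  · have hsin := (sin_angle_pos hs hsp).ne'
    have hs' := hs.ne'
    constructor
    · simp [greenValue, hs']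
    · simp only [greenValue, if_neg hs', Nat.cast_one, one_mul, div_self hsin, Complex.ofReal_one]
    · intro i
      rw [← Complex.ofReal_mul, ← Complex.ofReal_sub, Complex.ofReal_inj]
      simp only [greenValue, if_neg hs']
      push_cast
      generalize (s : ℝ) * π / p = θ at hsin ⊢
      rw [← mul_div_assoc, ← sub_div]
      congr 1
      have h1 : ((i : ℝ) + 2) * θ = (i + 1) * θ + θ := by ring
      have h2 : (i : ℝ) * θ = (i + 1) * θ - θ := by ring
      rw [h1, h2, sin_add, sin_sub]
      ring
    · have : (p : ℝ) * (s * π / p) = s * π := by field_simp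
      simp [greenValue, hs', this, sin_nat_mul_pi]

theorem two_cos_angle_injective {s s' : ℕ} (hs : s < p) (hs' : s' < p)
    (h : ((2 * cos (s * π / p) : ℝ) : ℂ) = ((2 * cos (s' * π / p) : ℝ) : ℂ)) : s = s' := by
  rw [Complex.ofReal_inj, mul_right_inj' two_ne_zero] at h
  have hp0 : (p : ℝ) ≠ 0 := by exact_mod_cast (by omega : p ≠ 0)
  have := injOn_cos ⟨by positivity, (angle_lt_pi hs).le⟩ ⟨by positivity, (angle_lt_pi hs').le⟩ h
  field_simp at this
  exact_mod_cast this

theorem greenValue_sub_left {m : ℕ} (hm : 0 < m) (hmp : m < p) (l : ℕ) :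
    greenValue p (p - m) l = -((-1) ^ l * greenValue p m l) := by
  have hp0 : (p : ℝ) ≠ 0 := by exact_mod_cast (by omega : p ≠ 0)
  have h1 : ((p - m : ℕ) : ℝ) * π / p = π - m * π / p := by
    rw [Nat.cast_sub hmp.le]
    field_simp
  rw [greenValue, greenValue, if_neg (by omega), if_neg (by omega), h1, sin_pi_sub, mul_sub,
    sin_nat_mul_pi_sub]
  ring

/-- Away from `s = 0`, passing from `V_l` to `V_{p-l}` changes eigenvalues only by a sign; hence
both have the same second largest modulus. -/
theorem greenValue_sub_right {m : ℕ} (hm : 0 < m) {l : ℕ} (hlp : l ≤ p) (hp : 0 < p) :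
    greenValue p m (p - l) = -((-1) ^ m * greenValue p m l) := by
  have hp0 : (p : ℝ) ≠ 0 := by exact_mod_cast hp.ne'
  have h1 : ((p - l : ℕ) : ℝ) * (m * π / p) = m * π - l * (m * π / p) := by
    rw [Nat.cast_sub hlp]
    field_simp
  rw [greenValue, greenValue, if_neg (by omega), if_neg (by omega), h1, sin_nat_mul_pi_sub]
  ring

end GreenValue

/-! ### Comparing the moduli of the eigenvalues -/

section Inequalities

/-- This says that `sin (l x) / sin x` decreases in `x`, with denominators cleared. Induct on `l` by
the addition formula, using that cosine decreases. -/
theorem sin_nat_mul_mul_sin_le {x y : ℝ} (hx : 0 ≤ x) (hxy : x ≤ y) (hy : y ≤ π / 2) {l : ℕ}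
    (hl : l * y ≤ π / 2) : sin (l * y) * sin x ≤ sin (l * x) * sin y := by
  induction l with
  | zero => simp
  | succ l ih =>
    push_cast at hl ⊢
    have hπ := pi_pos
    have hl0 : (0 : ℝ) ≤ l := Nat.cast_nonneg l
    have hly : l * y ≤ π / 2 := by nlinarith
    have hlxy : l * x ≤ l * y := mul_le_mul_of_nonneg_left hxy hl0
    have hlx0 : 0 ≤ l * x := mul_nonneg hl0 hx
    have h1 : 0 ≤ cos y := cos_nonneg_of_neg_pi_div_two_le_of_le (by linarith) hy
    have h2 : cos y ≤ cos x := cos_le_cos_of_nonneg_of_le_pi hx (by linarith) hxy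
    have h3 : cos (l * y) ≤ cos (l * x) :=
      cos_le_cos_of_nonneg_of_le_pi hlx0 (by linarith) hlxy
    have h4 : 0 ≤ sin (l * x) := sin_nonneg_of_nonneg_of_le_pi hlx0 (by linarith)
    have h5 : 0 ≤ sin y := sin_nonneg_of_nonneg_of_le_pi (by linarith) (by linarith)
    have h6 : 0 ≤ sin x := sin_nonneg_of_nonneg_of_le_pi hx (by linarith)
    rw [add_mul, add_mul, one_mul, one_mul, sin_add, sin_add]
    have e1 := mul_le_mul_of_nonneg_right (ih hly) h1
    have e2 := mul_le_mul_of_nonneg_left h2 (mul_nonneg h4 h5)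
    have e3 := mul_le_mul_of_nonneg_right h3 (mul_nonneg h5 h6)
    linarith

/-- Once `l * y` exceeds `π / 2`, monotonicity is lost. The comparison then goes through `z = π / (2
l)`, where `sin (l z) = 1`: the quotient at `y` is at most `1 / sin y ≤ 1 / sin z`, and the quotient
at `x` is at least `1 / sin z`. -/
theorem abs_sin_nat_mul_mul_sin_le {x y : ℝ} (hx : 0 ≤ x) (hxy : x ≤ y) (hy : y ≤ π / 2) {l : ℕ}
    (hl : 1 ≤ l) (hlx : l * x ≤ π / 2) : |sin (l * y)| * sin x ≤ sin (l * x) * sin y := by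
  have hπ := pi_pos
  have hl0 : (1 : ℝ) ≤ l := by exact_mod_cast hl
  have hx' : x ≤ π / 2 := hxy.trans hy
  rcases le_or_gt (l * y) (π / 2) with h | h
  · rw [abs_of_nonneg (sin_nonneg_of_nonneg_of_le_pi (by nlinarith) (by linarith))]
    exact sin_nat_mul_mul_sin_le hx hxy hy h
  · have hlz : l * (π / (2 * l)) = π / 2 := by field_simp
    have hxz : x ≤ π / (2 * l) := by
      by_contra! hc
      nlinarith
    have hzy : π / (2 * l) ≤ y := by
      by_contra! hc
      nlinarith
    have h1 := sin_nat_mul_mul_sin_le hx hxz (hzy.trans hy) hlz.le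
    rw [hlz, sin_pi_div_two, one_mul] at h1
    have h2 : sin (π / (2 * l)) ≤ sin y :=
      sin_le_sin_of_le_of_le_pi_div_two (by linarith) hy hzy
    have h3 : 0 ≤ sin (l * x) := sin_nonneg_of_nonneg_of_le_pi (by positivity) (by linarith)
    have h4 : 0 ≤ sin x := sin_nonneg_of_nonneg_of_le_pi hx (by linarith)
    calc |sin (l * y)| * sin x ≤ 1 * sin x :=
          mul_le_mul_of_nonneg_right (abs_sin_le_one _) h4
      _ ≤ sin (l * x) * sin (π / (2 * l)) := by rwa [one_mul]
      _ ≤ sin (l * x) * sin y := mul_le_mul_of_nonneg_left h2 h3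

/-- Strictness comes from `cos x < 1` in the base case; the inductive step only needs `cos ≤ 1`. -/
theorem sin_nat_mul_lt {x : ℝ} (hx : 0 < x) {l : ℕ} (hl : 1 ≤ l) (hlx : (l + 1) * x ≤ π / 2) :
    sin ((l + 1) * x) < (l + 1) * sin x := by
  have hπ := pi_pos
  induction l, hl using Nat.le_induction with
  | base =>
    norm_num at hlx ⊢
    have h1 : 0 < sin x := sin_pos_of_pos_of_lt_pi hx (by linarith)
    have h2 : cos x < 1 := by
      rw [← cos_zero]
      exact cos_lt_cos_of_nonneg_of_le_pi_div_two le_rfl (by linarith) hx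
    rw [sin_two_mul]
    nlinarith
  | succ l hl ih =>
    push_cast at hlx ⊢
    have h1 : 0 < sin x := sin_pos_of_pos_of_lt_pi hx (by nlinarith)
    have h3 := ih (by nlinarith)
    have h4 : 0 ≤ sin ((l + 1) * x) :=
      sin_nonneg_of_nonneg_of_le_pi (by positivity) (by nlinarith)
    have h5 := mul_le_mul_of_nonneg_left (cos_le_one x) h4
    have h6 := mul_le_mul_of_nonneg_right (cos_le_one ((l + 1) * x)) h1.le
    rw [add_mul _ 1, one_mul, sin_add]
    linarith

variable {p n : ℕ} (hpn : p = 2 * n + 1)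

include hpn

theorem abs_greenValue_le {l m : ℕ} (hl : 1 ≤ l) (hln : l ≤ n) (hm : 1 ≤ m) (hmp : m < p) :
    |greenValue p m l| ≤ greenValue p 1 l := by
  -- Replacing `m` by `p - m` keeps the modulus and brings the angle into `[0, π / 2]`.
  wlog hmn : m ≤ n generalizing m
  · have := this (m := p - m) (by omega) (by omega) (by omega)
    rw [greenValue_sub_left (by omega) hmp, abs_neg, abs_mul, abs_pow, abs_neg, abs_one, one_pow,
      one_mul] at this
    exact this
  have hπ := pi_pos
  have hp0 : (0 : ℝ) < p := by exact_mod_cast (by omega : 0 < p)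
  have hhalf {a : ℕ} (ha : a ≤ n) : (a : ℝ) * π / p ≤ π / 2 := by
    have : (2 * a : ℝ) ≤ p := by exact_mod_cast (by omega : 2 * a ≤ p)
    rw [div_le_div_iff₀ hp0 two_pos]
    nlinarith
  have hm' : (1 : ℝ) ≤ m := by exact_mod_cast hm
  have hsm := sin_angle_pos hm hmp
  have hs1 := sin_angle_pos (p := p) one_pos (by omega)
  have key := abs_sin_nat_mul_mul_sin_le (x := (1 : ℕ) * π / p) (y := m * π / p) (by positivity)
    (by rw [Nat.cast_one]; gcongr) (hhalf hmn) hl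
    (by rw [Nat.cast_one, one_mul, ← mul_div_assoc]; exact hhalf hln)
  rw [greenValue, greenValue, if_neg (by omega), if_neg one_ne_zero, abs_div, abs_of_pos hsm,
    div_le_div_iff₀ hsm hs1]
  exact key

theorem greenValue_one_lt {l : ℕ} (hl : 2 ≤ l) (hln : l ≤ n) : greenValue p 1 l < l := by
  have hπ := pi_pos
  have hp0 : (0 : ℝ) < p := by exact_mod_cast (by omega : 0 < p)
  have hs1 := sin_angle_pos (p := p) one_pos (by omega)
  rw [greenValue, if_neg one_ne_zero, div_lt_iff₀ hs1]
  obtain ⟨q, rfl⟩ : ∃ q, l = q + 1 := ⟨l - 1, by omega⟩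
  have := sin_nat_mul_lt (x := (1 : ℕ) * π / p) (by positivity) (l := q) (by omega) (by
    have : (2 * (q + 1) : ℝ) ≤ p := by exact_mod_cast (by omega : 2 * (q + 1) ≤ p)
    rw [Nat.cast_one, one_mul, ← mul_div_assoc, div_le_div_iff₀ hp0 two_pos]
    nlinarith)
  push_cast at this ⊢
  exact this

theorem greenValue_one_one (hn : 1 ≤ n) : greenValue p 1 1 = 1 := by
  have hs1 := sin_angle_pos (p := p) one_pos (by omega)
  rw [greenValue, if_neg one_ne_zero, Nat.cast_one, one_mul]
  rw [Nat.cast_one] at hs1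
  exact div_self hs1.ne'

end Inequalities

/-! ### Sums of consecutive roots of unity -/

section RootSum

open Complex in
-- With `q = exp (i m π / p)` the sum is a geometric series of ratio `q ^ 2` whose exponents of `q`
-- are centred at `p`. Factoring out `q ^ p = (-1) ^ m` leaves the symmetric sum `sin (2 r θ) / sin
-- θ` with `θ = m π / p`.
theorem consecutiveRootSum_eq {p n r m : ℕ} (hpn : p = 2 * n + 1) (hr : r ≤ n) (hm : 1 ≤ m)
    (hmp : m < p) :
    consecutiveRootSum n r m = (((-1) ^ m * greenValue p m (2 * r) : ℝ) : ℂ) := by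
  have hsin := (sin_angle_pos hm hmp).ne'
  have hp0 : (p : ℂ) ≠ 0 := by exact_mod_cast (by omega : p ≠ 0)
  set q : ℂ := exp ((m * π / p : ℝ) * I) with hq
  have hq0 : q ≠ 0 := exp_ne_zero _
  have hω : exp (2 * π * I / (2 * n + 1)) ^ m = q ^ 2 := by
    rw [hq, ← Complex.exp_nat_mul, ← Complex.exp_nat_mul]
    congr 1
    have : (2 * n + 1 : ℂ) = p := by rw [hpn]; push_cast; ring
    rw [this]
    push_cast
    ring
  have hqp : q ^ (2 * n + 1) = (-1) ^ m := by
    rw [hq, ← Complex.exp_nat_mul, ← hpn, ← exp_pi_mul_I, ← Complex.exp_nat_mul]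
    congr 1
    push_cast
    field_simp
  have hsinq (N : ℕ) : ((Real.sin (N * (m * π / p)) : ℝ) : ℂ) = ((q ^ N)⁻¹ - q ^ N) * I / 2 := by
    rw [ofReal_sin, Complex.sin, hq, ← Complex.exp_nat_mul, ← Complex.exp_neg]
    push_cast
    congr 4 <;> ring_nf
  have hsum : consecutiveRootSum n r m * (q ^ 2 - 1) =
      q ^ (2 * (n - r + 1)) * (q ^ (4 * r) - 1) := by
    have h1 : consecutiveRootSum n r m =
        (q ^ 2) ^ (n - r + 1) * ∑ j ∈ Finset.range (2 * r), (q ^ 2) ^ j := by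
      rw [consecutiveRootSum, ← Finset.Ico_succ_right_eq_Icc, Finset.sum_Ico_eq_sum_range,
        Finset.mul_sum]
      refine Finset.sum_congr (by simp) fun j _ => ?_
      rw [pow_right_comm, hω, ← pow_add, add_assoc]
    rw [h1, mul_assoc, geom_sum_mul, ← pow_mul, ← pow_mul]
    congr 3
    ring
  have hs1 := hsinq 1
  rw [Nat.cast_one, one_mul, pow_one] at hs1
  have hs0 : ((Real.sin (m * π / p) : ℝ) : ℂ) ≠ 0 := by exact_mod_cast hsin
  rw [greenValue, if_neg (by omega), ofReal_mul, ofReal_div, mul_div_assoc', eq_div_iff hs0,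
    hs1, hsinq, ofReal_pow, ofReal_neg, ofReal_one, ← hqp]
  have e1 : q ^ (2 * (n - r + 1)) * q ^ (2 * r) = q ^ (2 * n + 2) := by
    rw [← pow_add]
    congr 1
    omega
  have e2 : consecutiveRootSum n r m * (q ^ 2 - 1) = q ^ (2 * n + 2) * (q ^ (2 * r) -
      (q ^ (2 * r))⁻¹) := by
    rw [hsum, ← e1]
    have : q ^ (4 * r) = q ^ (2 * r) * q ^ (2 * r) := by
      rw [← pow_add]
      congr 1
      omega
    rw [this]
    field_simp
  have e3 : q⁻¹ - q = -(q ^ 2 - 1) / q := by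
    field_simp
    ring
  rw [e3]
  have : consecutiveRootSum n r m * (-(q ^ 2 - 1) / q * I / 2) =
      (consecutiveRootSum n r m * (q ^ 2 - 1)) * (-I / 2 / q) := by ring
  rw [this, e2]
  field_simp
  ring

end RootSum

/-! ### Pairing `m` with `p - m`, and reading off the second modulus -/

theorem multiset_range_eq {p n : ℕ} (hpn : p = 2 * n + 1) :
    Multiset.range p =
      0 ::ₘ ((Finset.Icc 1 n).val + (Finset.Icc 1 n).val.map (fun m => p - m)) := by
  have h2 : ((Finset.Icc 1 n).val.map (fun m => p - m)).Nodup := by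
    refine Multiset.Nodup.map_on (fun x hx y hy h => ?_) (Finset.Icc 1 n).nodup
    rw [Finset.mem_val, Finset.mem_Icc] at hx hy
    omega
  refine (Multiset.Nodup.ext (Multiset.nodup_range p) ?_).2 fun s => ?_
  · rw [Multiset.nodup_cons, Multiset.nodup_add]
    refine ⟨?_, (Finset.Icc 1 n).nodup, h2, ?_⟩
    · simp only [Multiset.mem_add, Multiset.mem_map, Finset.mem_val, Finset.mem_Icc]
      rintro (h | ⟨m, h, h'⟩) <;> omega
    · rw [Multiset.disjoint_left]
      intro x hx hx'
      simp only [Multiset.mem_map, Finset.mem_val, Finset.mem_Icc] at hx hx'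
      obtain ⟨m, h, h'⟩ := hx'
      omega
  · simp only [Multiset.mem_range, Multiset.mem_cons, Multiset.mem_add, Multiset.mem_map,
      Finset.mem_val, Finset.mem_Icc]
    constructor
    · intro h
      by_cases h0 : s = 0
      · exact Or.inl h0
      by_cases h1 : s ≤ n
      · exact Or.inr (Or.inl ⟨by omega, h1⟩)
      · exact Or.inr (Or.inr ⟨p - s, ⟨by omega, by omega⟩, by omega⟩)
    · rintro (h | h | ⟨m, h, h'⟩) <;> omega

/-- Needed because the parity of `m` decides which of the indices `m` and `p - m` carries the sum
and which its negative. -/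
theorem map_add_map_congr {α β : Type*} {s : Multiset α} {f g f' g' : α → β}
    (h : ∀ x ∈ s, (f x = f' x ∧ g x = g' x) ∨ (f x = g' x ∧ g x = f' x)) :
    s.map f + s.map g = s.map f' + s.map g' := by
  induction s using Multiset.induction with
  | empty => simp
  | cons x s ih =>
    have ih' := ih fun y hy => h y (Multiset.mem_cons_of_mem hy)
    simp only [Multiset.map_cons, Multiset.cons_add, Multiset.add_cons, ih']
    rcases h x (Multiset.mem_cons_self x s) with ⟨h1, h2⟩ | ⟨h1, h2⟩
    · rw [h1, h2]
    · rw [h1, h2, Multiset.cons_swap]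

theorem secondLargestModulus_eq {ι : Type*} [Fintype ι] [DecidableEq ι] {M : Matrix ι ι ℂ} {p : ℕ}
    {a : ℕ → ℝ} {D : ℝ} (hM : M.charpoly.roots = (Multiset.range p).map (fun s => (a s : ℂ)))
    (hp : 1 < p) (h1 : |a 1| = D) (hle : ∀ s, 1 ≤ s → s < p → |a s| ≤ D) (hlt : D < |a 0|) :
    secondLargestModulus M = D := by
  have hspec (μ : ℂ) : μ ∈ spectrum ℂ M ↔ ∃ s < p, (a s : ℂ) = μ := by
    rw [Matrix.mem_spectrum_iff_isRoot_charpoly,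
      ← Polynomial.mem_roots (Matrix.charpoly_monic M).ne_zero, hM]
    simp
  refine IsGreatest.csSup_eq ⟨?_, ?_⟩
  · refine ⟨a 1, (hspec _).2 ⟨1, hp, rfl⟩, ?_, a 0, (hspec _).2 ⟨0, by omega, rfl⟩, ?_⟩
    · rw [Complex.norm_real, norm_eq_abs, h1]
    · rw [Complex.norm_real, norm_eq_abs, Complex.norm_real, norm_eq_abs, h1]
      exact hlt
  · rintro _ ⟨μ, hμ, rfl, ν, hν, hμν⟩
    obtain ⟨s, hs, rfl⟩ := (hspec _).1 hμ
    obtain ⟨s', hs', rfl⟩ := (hspec _).1 hν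
    rw [Complex.norm_real, norm_eq_abs, Complex.norm_real, norm_eq_abs] at hμν
    rw [Complex.norm_real, norm_eq_abs]
    rcases Nat.eq_zero_or_pos s with rfl | h
    · rcases Nat.eq_zero_or_pos s' with rfl | h'
      · exact absurd hμν (lt_irrefl _)
      · exact absurd (hle s' h' hs') (by linarith)
    · exact hle s h hs

end UnipotentBlock

/-! ### Assembly -/

theorem theorem4p4 (p n : ℕ) (hp : p.Prime) (hpn : p = 2 * n + 1)
    {k : Type*} [Field k] [IsAlgClosed k] [CharP k p]
    {G : Type*} [Group G] [IsCyclic G] (hG : Nat.card G = p)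
    {V : ℕ → Type*} [∀ i, AddCommGroup (V i)] [∀ i, Module k (V i)]
    (ρ : ∀ i, Representation k G (V i))
    -- `V 1, …, V p` are the indecomposables of dimension `1, …, p`; other indices play no role
    (hdim : ∀ i, 1 ≤ i → i ≤ p → Module.finrank k (V i) = i)
    (hind : ∀ i, 1 ≤ i → i ≤ p → (ρ i).IsIndecomposable) :
    (∀ l, 1 ≤ l → l ≤ n →
      lambdaSec p ρ l =
          Real.sin (l * Real.pi / (2 * n + 1)) / Real.sin (Real.pi / (2 * n + 1)) ∧
        lambdaSec p ρ (p - l) =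
          Real.sin (l * Real.pi / (2 * n + 1)) / Real.sin (Real.pi / (2 * n + 1))) ∧
    -- the eigenvalues with algebraic multiplicity, for `l = 2 * r` and for `l = p - 2 * r`
    (∀ r, 1 ≤ r → r ≤ n →
      (actionMatrix (ρ (2 * r)) p ρ).charpoly.roots =
          ((2 * r : ℕ) : ℂ) ::ₘ
            ((Finset.Icc 1 n).val.map (fun m => consecutiveRootSum n r m) +
              (Finset.Icc 1 n).val.map (fun m => -consecutiveRootSum n r m)) ∧
        (actionMatrix (ρ (p - 2 * r)) p ρ).charpoly.roots =
          ((p - 2 * r : ℕ) : ℂ) ::ₘ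
            (2 • (Finset.Icc 1 n).val.map (fun m => -consecutiveRootSum n r m))) := by
  open UnipotentBlock in
  have hroots {l : ℕ} (hl : 1 ≤ l) (hlp : l ≤ p) : (actionMatrix (ρ l) p ρ).charpoly.roots =
      (Multiset.range p).map (fun s => (greenValue p s l : ℂ)) :=
    charpoly_actionMatrix hp hG hdim hind (fun s hs => isGreenChar_greenValue hs)
      (fun s hs s' hs' h => two_cos_angle_injective hs hs' h) hl hlp
  have hzero (l : ℕ) : greenValue p 0 l = l := if_pos rfl
  refine ⟨fun l hl hln => ?_, fun r hr hrn => ?_⟩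
  · have hval : Real.sin (l * Real.pi / (2 * n + 1)) / Real.sin (Real.pi / (2 * n + 1)) =
        greenValue p 1 l := by
      have : (p : ℝ) = 2 * n + 1 := by rw [hpn]; push_cast; rfl
      rw [greenValue, if_neg one_ne_zero, this, Nat.cast_one, one_mul, mul_div_assoc]
    have hnonneg : 0 ≤ greenValue p 1 l :=
      (abs_nonneg _).trans (abs_greenValue_le hpn hl hln le_rfl (by omega))
    rw [hval]
    constructor
    · rw [lambdaSec]
      split_ifs with h1
      · rw [h1, greenValue_one_one hpn (by omega)]
      · refine secondLargestModulus_eq (hroots hl (by omega)) (by omega) (abs_of_nonneg hnonneg)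
          (fun s hs hsp => abs_greenValue_le hpn hl hln hs hsp) ?_
        rw [hzero, Nat.abs_cast]
        exact greenValue_one_lt hpn (by omega) hln
    · rw [lambdaSec, if_neg (by omega)]
      have habs (s : ℕ) (hs : 1 ≤ s) : |greenValue p s (p - l)| = |greenValue p s l| := by
        rw [greenValue_sub_right hs (by omega) (by omega), abs_neg, abs_mul, abs_pow, abs_neg,
          abs_one, one_pow, one_mul]
      refine secondLargestModulus_eq (hroots (by omega) (by omega)) (by omega)
        ((habs 1 le_rfl).trans (abs_of_nonneg hnonneg))
        (fun s hs hsp => (habs s hs).trans_le (abs_greenValue_le hpn hl hln hs hsp)) ?_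
      rw [hzero, Nat.abs_cast]
      -- Equality occurs at `l = 1`; strict dominance of the eigenvalue `p - l` comes from `l < p -
      -- l`.
      have h1 : greenValue p 1 l ≤ l := by
        rcases hl.eq_or_lt with h | h
        · rw [← h, greenValue_one_one hpn (by omega), Nat.cast_one]
        · exact (greenValue_one_lt hpn h hln).le
      exact h1.trans_lt (by exact_mod_cast (by omega : l < p - l))
  · have hS {m : ℕ} (hm : m ∈ (Finset.Icc 1 n).val) : 1 ≤ m ∧ m < p ∧ consecutiveRootSum n r m =
        (((-1) ^ m * greenValue p m (2 * r) : ℝ) : ℂ) := by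
      rw [Finset.mem_val, Finset.mem_Icc] at hm
      exact ⟨hm.1, by omega, consecutiveRootSum_eq hpn hrn hm.1 (by omega)⟩
    constructor
    · rw [hroots (by omega) (by omega), multiset_range_eq hpn, Multiset.map_cons,
        Multiset.map_add, Multiset.map_map, hzero, Complex.ofReal_natCast]
      congr 1
      refine map_add_map_congr fun m hm => ?_
      obtain ⟨hm1, hmp, hm⟩ := hS hm
      rw [Function.comp_apply, greenValue_sub_left hm1 hmp, hm, pow_mul, neg_one_sq, one_pow,
        one_mul]
      rcases neg_one_pow_eq_or ℝ m with h | h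
      · left
        rw [h, one_mul]
        exact ⟨rfl, Complex.ofReal_neg _⟩
      · right
        rw [h]
        push_cast
        constructor <;> ring
    · rw [hroots (by omega) (by omega), multiset_range_eq hpn, Multiset.map_cons,
        Multiset.map_add, Multiset.map_map, hzero, Complex.ofReal_natCast, two_nsmul]
      congr 1
      refine map_add_map_congr fun m hm => ?_
      obtain ⟨hm1, hmp, hm⟩ := hS hm
      -- In odd dimension the indices `m` and `p - m` give the same eigenvalue, whence the
      -- multiplicity two.
      have hodd : Odd (p - 2 * r) := ⟨n - r, by omega⟩
      have h1 : ((greenValue p m (p - 2 * r) : ℝ) : ℂ) = -consecutiveRootSum n r m := by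
        rw [hm, greenValue_sub_right hm1 (by omega) (by omega), Complex.ofReal_neg]
      rw [Function.comp_apply, greenValue_sub_left hm1 hmp, hodd.neg_one_pow, neg_one_mul,
        neg_neg]
      exact Or.inl ⟨h1, h1⟩
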